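/- Let $\mathbb{S}^3$ be the unit sphere of $\mathbb{E}^4$. A $4$-polytope (the convex hull of finitely many points of $\mathbb{E}^4$, of full dimension) is \emph{edge-scribed} if its vertices lie outside $\mathbb{S}^3$ and each of its edges is tangent to $\mathbb{S}^3$. The \emph{ball-arrangement projection} of an edge-scribed $4$-polytope $\mathcal{Q}$ is the collection of the sets $b_v\subset\widehat{\mathbb{R}^3}=\mathbb{R}^3\cup\{\infty\}$, one for each vertex $v$ of $\mathcal{Q}$, where $b_v$ is the image under stereographic projection from the north pole $(0,0,0,1)$ of the region of $\mathbb{S}^3$ illuminated by a light source at $v$. An edge-scribed realization of a $4$-polytope $\mathcal{P}$ is an edge-scribed $4$-polytope whose face lattice is isomorphic to that of $\mathcal{P}$. The polytope $\mathcal{P}$ is \emph{Möbius unique} if it has an edge-scribed realization and if, for any two edge-scribed realizations of $\mathcal{P}$, there is a Möbius transformation of $\widehat{\mathbb{R}^3}$ (an element of the group generated by the inversions in spheres and the reflections in planes) that maps the ball-arrangement projection of the one onto that of the other. **Proposition.** The $24$-cell, i.e. the convex hull of the $24$ points obtained from $(\pm1,\pm1,0,0)$ by permuting the coordinates, is Möbius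 unique. -/

import Mathlib

open scoped RealInnerProductSpace OnePoint

noncomputable section

namespace MobiusPolytope

/-- The Euclidean space of dimension `n`. -/
abbrev E (n : ℕ) : Type := EuclideanSpace ℝ (Fin n)

/-! ### Polytopes and their faces -/

/-- An `n`-polytope in `n`-dimensional Euclidean space: the convex hull of finitely many points,
of full dimension. -/
def IsPolytope {n : ℕ} (P : Set (E n)) : Prop :=
  (∃ s : Set (E n), s.Finite ∧ P = convexHull ℝ s) ∧ affineSpan ℝ P = ⊤

/-- The faces of `P` (the empty face and `P` itself included), ordered by inclusion. A nonempty
face is the set of points of `P` at which some linear functional is maximal on `P`. -/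
abbrev Face {n : ℕ} (P : Set (E n)) : Type := {F : Set (E n) // IsExposed ℝ P F}

/-- Two polytopes are combinatorially equivalent if their face lattices are isomorphic. -/
def CombEquiv {n m : ℕ} (P : Set (E n)) (Q : Set (E m)) : Prop :=
  Nonempty (Face P ≃o Face Q)

/-- The vertices of `P`: the points `v` such that `{v}` is a face. -/
def vertices {n : ℕ} (P : Set (E n)) : Set (E n) := {v | IsExposed ℝ P {v}}

/-- The edges of `P`: the faces that are nondegenerate segments. -/
def edges {n : ℕ} (P : Set (E n)) : Set (Set (E n)) :=
  {F | IsExposed ℝ P F ∧ ∃ u v : E n, u ≠ v ∧ F = segment ℝ u v}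

/-- The set `F` is tangent to the unit sphere: it touches the sphere at one of its points `x`, and
it is contained in the tangent hyperplane of the sphere at `x`. -/
def IsTangentToUnitSphere {n : ℕ} (F : Set (E n)) : Prop :=
  ∃ x ∈ F, ‖x‖ = 1 ∧ ∀ y ∈ F, ⟪x, y⟫ = 1

/-- An edge-scribed polytope: all its vertices lie outside the unit sphere and all its edges are
tangent to the unit sphere. -/
def IsEdgeScribed {n : ℕ} (P : Set (E n)) : Prop :=
  IsPolytope P ∧ (∀ v ∈ vertices P, 1 < ‖v‖) ∧ ∀ F ∈ edges P, IsTangentToUnitSphere F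

/-- `Q` is an edge-scribed realization of `P`. -/
def IsEdgeScribedRealization {n : ℕ} (P Q : Set (E n)) : Prop :=
  IsEdgeScribed Q ∧ CombEquiv P Q

/-! ### The ball-arrangement projection -/

/-- The part of the unit sphere illuminated by a light source at `v`: the points `x` of the sphere
that are seen from `v` without crossing the open unit ball. -/
def illuminated {n : ℕ} (v : E n) : Set (E n) :=
  {x | ‖x‖ = 1 ∧ Disjoint (segment ℝ v x) (Metric.ball 0 1)}

/-- The stereographic projection of the unit sphere of `E (d + 1)` from its north pole
`(0, …, 0, 1)` onto `E d ∪ {∞}`. The north pole (the only point of the sphere with last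
coordinate `1`) is sent to `∞`. -/
def stereo {d : ℕ} (x : E (d + 1)) : OnePoint (E d) :=
  open Classical in
  if x (Fin.last d) = 1 then ∞
  else ((WithLp.toLp 2 fun i : Fin d => x i.castSucc / (1 - x (Fin.last d)) : E d) :
    OnePoint (E d))

/-- The ball-arrangement projection of `P`: the collection of the stereographic images of the
regions of the unit sphere illuminated from the vertices of `P`. -/
def ballArrangement {d : ℕ} (P : Set (E (d + 1))) : Set (Set (OnePoint (E d))) :=
  (fun v => stereo '' illuminated v) '' vertices P

/-! ### Möbius transformations of `E d ∪ {∞}` -/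

/-- The inversion of `E d ∪ {∞}` in the sphere with centre `c` and radius `r`. It exchanges `c`
and `∞`. -/
def sphereInversionFun {d : ℕ} (c : E d) (r : ℝ) : OnePoint (E d) → OnePoint (E d) :=
  open Classical in
  fun p => p.elim (c : OnePoint (E d))
    (fun x => if x = c then ∞ else ((EuclideanGeometry.inversion c r x : E d) : OnePoint (E d)))

theorem sphereInversionFun_involutive {d : ℕ} (c : E d) {r : ℝ} (hr : r ≠ 0) :
    Function.Involutive (sphereInversionFun c r) := by
  intro x
  induction x using OnePoint.rec with
  | infty => simp [sphereInversionFun]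
  | coe x =>
    by_cases h : x = c
    · simp [sphereInversionFun, h]
    · have h' : EuclideanGeometry.inversion c r x ≠ c := by
        rwa [Ne, EuclideanGeometry.inversion_eq_center hr]
      simp [sphereInversionFun, h, h', EuclideanGeometry.inversion_inversion c hr]

/-- The inversion in a sphere, as a permutation of `E d ∪ {∞}`. -/
def sphereInversion {d : ℕ} (c : E d) (r : ℝ) (hr : r ≠ 0) : Equiv.Perm (OnePoint (E d)) :=
  (sphereInversionFun_involutive c hr).toPerm

/-- The reflection in an affine subspace, as a permutation of `E d ∪ {∞}` that fixes `∞`. -/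
def extendedReflection {d : ℕ} (H : AffineSubspace ℝ (E d)) [Nonempty H] :
    Equiv.Perm (OnePoint (E d)) :=
  Equiv.optionCongr (EuclideanGeometry.reflection H).toEquiv

/-- The Möbius group of `E d ∪ {∞}`: the group generated by the inversions in spheres and the
reflections in hyperplanes. -/
def mobiusGroup (d : ℕ) : Subgroup (Equiv.Perm (OnePoint (E d))) :=
  Subgroup.closure
    ({f | ∃ (c : E d) (r : ℝ) (hr : 0 < r), f = sphereInversion c r hr.ne'} ∪
      {f | ∃ (H : AffineSubspace ℝ (E d)) (_ : Nonempty H),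
        Module.finrank ℝ H.direction + 1 = d ∧ f = extendedReflection H})

/-- Two collections of subsets of `E d ∪ {∞}` are Möbius equivalent if some Möbius transformation
carries the one onto the other. -/
def MobiusEquivalent {d : ℕ} (A B : Set (Set (OnePoint (E d)))) : Prop :=
  ∃ μ ∈ mobiusGroup d, (fun b => μ '' b) '' A = B

/-- A polytope is Möbius unique if it is edge-scribable and the ball-arrangement projections of
all its edge-scribed realizations are Möbius equivalent. -/
def IsMobiusUnique {d : ℕ} (P : Set (E (d + 1))) : Prop :=
  (∃ Q, IsEdgeScribedRealization P Q) ∧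
    ∀ Q Q', IsEdgeScribedRealization P Q → IsEdgeScribedRealization P Q' →
      MobiusEquivalent (ballArrangement Q) (ballArrangement Q')

/-! ### The 24-cell -/

/-- The (regular) 24-cell: the convex hull of the 24 points obtained from `(±1, ±1, 0, 0)` by
permuting coordinates, that is, of the points with coordinates in `{-1, 0, 1}` exactly two of
which are nonzero. -/
def twentyFourCell : Set (E 4) :=
  convexHull ℝ {x | (∀ i, x i = -1 ∨ x i = 0 ∨ x i = 1) ∧ {i | x i ≠ 0}.ncard = 2}

end MobiusPolytope

end

noncomputable section

namespace MobiusPolytope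

/-! ### The Lorentz space -/

/-! The argument lives in the five-dimensional Lorentz space `E 4 × ℝ`. A point `v` outside the
sphere lifts to a unit spacelike vector `unitLift v`, and the cap illuminated from `v` consists of
the light rays on the nonnegative side of that vector (`ballArrangement_eq`). Tangency of an edge
says that the lifts of its ends have product `-1` (`lorentz_of_isTangentToUnitSphere`). Lorentz
reflections along spacelike vectors act on the light cone as inversions and reflections
(`inducesMobius_lorentzReflection`). So it suffices to carry the lifted vertices of one realization
to those of the other by a product of such reflections.

The rigidity comes from the octahedral facets. The lifts of a facet lie in a hyperplane, of
dimension four. The three differences of opposite vertices are non-null, mutually orthogonal and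
orthogonal to all sums of opposite vertices, which leaves only a line for the sums. Hence opposite
pairs have the same sum, and opposite vertices have product `-3` (`octahedron_rigid`).

Three octahedra surround each edge. Their vertices opposite to each other, together with the ends of
the edge, thus have a prescribed Gram matrix (`IsConfiguration.gram_flag`), and an isometry matching
these five vectors exists by a Witt-type argument (`exists_inducesMobius`). Equality of the sums is
a linear relation, so the matching spreads from facet to facet over all 24 vertices. For existence,
the regular cell is scaled until its edge midpoints lie on the sphere. -/

/-- The Lorentz form on `E n × ℝ`. -/
def lorentz (n : ℕ) : LinearMap.BilinForm ℝ (E n × ℝ) :=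
  LinearMap.mk₂ ℝ (fun x y => ⟪x.1, y.1⟫ - x.2 * y.2)
    (fun x x' y => by simp [inner_add_left]; ring)
    (fun c x y => by simp [inner_smul_left]; ring)
    (fun x y y' => by simp [inner_add_right]; ring)
    (fun c x y => by simp [inner_smul_right]; ring)

theorem lorentz_apply {n : ℕ} (x y : E n × ℝ) : lorentz n x y = ⟪x.1, y.1⟫ - x.2 * y.2 := rfl

theorem lorentz_comm {n : ℕ} (x y : E n × ℝ) : lorentz n x y = lorentz n y x := by
  rw [lorentz_apply, lorentz_apply, real_inner_comm, mul_comm]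

/-- A nonzero vector orthogonal to a timelike vector is spacelike. -/
theorem eq_zero_or_lorentz_pos {n : ℕ} {c w : E n × ℝ} (hc : lorentz n c c < 0)
    (hw : lorentz n c w = 0) : w = 0 ∨ 0 < lorentz n w w := by
  obtain ⟨v, t⟩ := c
  obtain ⟨u, s⟩ := w
  simp only [lorentz_apply, real_inner_self_eq_norm_sq] at hc hw ⊢
  -- Cauchy–Schwarz gives `|t| * |s| ≤ ‖v‖ * ‖u‖`; as `‖v‖ < |t|`, this forces `|s| < ‖u‖` unless `u
  -- = 0`.
  have hvt : ‖v‖ < |t| := by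
    rw [← abs_of_nonneg (norm_nonneg v)]; exact sq_lt_sq.1 (by linarith [sq t])
  have ht : 0 < |t| := (norm_nonneg v).trans_lt hvt
  have hts : |t| * |s| ≤ ‖v‖ * ‖u‖ := by
    rw [← abs_mul, ← sub_eq_zero.1 hw]; exact abs_real_inner_le_norm v u
  rcases eq_or_ne u 0 with rfl | hu
  · left
    have : |s| ≤ 0 := by
      by_contra! h
      have := mul_pos ht h
      simp at hts; linarith
    simpa using this
  · right
    have hu' : 0 < ‖u‖ := norm_pos_iff.2 hu
    have h : |s| < ‖u‖ := by
      by_contra! h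
      have h1 : ‖v‖ * ‖u‖ < |t| * ‖u‖ := mul_lt_mul_of_pos_right hvt hu'
      have h2 : |t| * ‖u‖ ≤ |t| * |s| := mul_le_mul_of_nonneg_left h ht.le
      linarith
    have := sq_lt_sq.2 (h.trans_eq (abs_of_nonneg hu'.le).symm)
    linarith [sq s]

/-- Two future timelike vectors have a negative product. -/
theorem lorentz_neg_of_timelike {n : ℕ} {c c' : E n × ℝ} (hc : lorentz n c c < 0)
    (hc' : lorentz n c' c' < 0) (h : 0 < c.2) (h' : 0 < c'.2) : lorentz n c c' < 0 := by
  simp only [lorentz_apply, real_inner_self_eq_norm_sq] at hc hc' ⊢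
  have h1 : ‖c.1‖ < c.2 := lt_of_pow_lt_pow_left₀ 2 h.le (by linarith [sq c.2])
  have h2 : ‖c'.1‖ < c'.2 := lt_of_pow_lt_pow_left₀ 2 h'.le (by linarith [sq c'.2])
  have h3 := real_inner_le_norm c.1 c'.1
  have h4 : ‖c.1‖ * ‖c'.1‖ < c.2 * c'.2 :=
    mul_lt_mul'' h1 h2 (norm_nonneg _) (norm_nonneg _)
  linarith

/-- The difference of two future timelike vectors of equal norm is zero or spacelike. -/
theorem sub_eq_zero_or_lorentz_pos {n : ℕ} {c c' : E n × ℝ} (hc : lorentz n c c < 0)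
    (hcc : lorentz n c' c' = lorentz n c c) (h : 0 < c.2) (h' : 0 < c'.2) :
    c - c' = 0 ∨ 0 < lorentz n (c - c') (c - c') := by
  have h1 := lorentz_neg_of_timelike hc (hcc.trans_lt hc) h h'
  -- The sum is timelike, and it is orthogonal to the difference because the norms agree.
  apply eq_zero_or_lorentz_pos (c := c + c')
  · simp only [map_add, LinearMap.add_apply, lorentz_comm c' c]; linarith
  · simp only [map_add, map_sub, LinearMap.add_apply, lorentz_comm c' c]; linarith

/-- The Lorentz reflection along the vector `w`. -/
def lorentzReflection {n : ℕ} (w : E n × ℝ) : (E n × ℝ) →ₗ[ℝ] (E n × ℝ) :=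
  LinearMap.id - (2 / lorentz n w w) • (lorentz n w).smulRight w

theorem lorentzReflection_apply {n : ℕ} (w x : E n × ℝ) :
    lorentzReflection w x = x - (2 / lorentz n w w * lorentz n w x) • w := by
  simp [lorentzReflection, smul_smul]

theorem lorentz_lorentzReflection {n : ℕ} {w : E n × ℝ} (hw : lorentz n w w ≠ 0) (x y : E n × ℝ) :
    lorentz n (lorentzReflection w x) (lorentzReflection w y) = lorentz n x y := by
  simp only [lorentzReflection_apply, map_sub, map_smul, LinearMap.sub_apply, LinearMap.smul_apply,
    smul_eq_mul, lorentz_comm x w]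
  field_simp
  ring

/-- The reflection along `x - y` exchanges the vectors `x` and `y` of equal norm. -/
theorem lorentzReflection_sub {n : ℕ} {x y : E n × ℝ} (h : lorentz n x x = lorentz n y y)
    (hw : lorentz n (x - y) (x - y) ≠ 0) : lorentzReflection (x - y) x = y := by
  have : 2 / lorentz n (x - y) (x - y) * lorentz n (x - y) x = 1 := by
    rw [div_mul_eq_mul_div, div_eq_one_iff_eq hw]
    simp only [map_sub, LinearMap.sub_apply, lorentz_comm y x]; linarith
  rw [lorentzReflection_apply, this, one_smul, sub_sub_cancel]

theorem lorentzReflection_of_orthogonal {n : ℕ} {w x : E n × ℝ} (h : lorentz n w x = 0) :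
    lorentzReflection w x = x := by
  simp [lorentzReflection_apply, h]

/-! ### Conformal coordinates and the light cone -/

/-- The vector of the Lorentz space with conformal coordinates `a`, `α` and `β`. -/
def conformal {d : ℕ} (a : E d) (α β : ℝ) : E (d + 1) × ℝ :=
  (WithLp.toLp 2 (Fin.snoc (α := fun _ => ℝ) a ((β - α) / 2)), (α + β) / 2)

theorem lorentz_conformal {d : ℕ} (a a' : E d) (α β α' β' : ℝ) :
    lorentz (d + 1) (conformal a α β) (conformal a' α' β') =
      ⟪a, a'⟫ - (α * β' + α' * β) / 2 := by
  simp only [lorentz_apply, conformal, PiLp.inner_apply, Fin.sum_univ_castSucc]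
  simp
  ring

theorem conformal_surjective {d : ℕ} (y : E (d + 1) × ℝ) :
    y = conformal (WithLp.toLp 2 fun i => y.1 i.castSucc) (y.2 - y.1 (Fin.last d))
      (y.2 + y.1 (Fin.last d)) := by
  refine Prod.ext ?_ ?_
  · ext i
    refine Fin.lastCases ?_ (fun i => ?_) i
    · simp [conformal]
    · simp [conformal]
  · simp [conformal]

theorem conformal_add {d : ℕ} (a a' : E d) (α β α' β' : ℝ) :
    conformal a α β + conformal a' α' β' = conformal (a + a') (α + α') (β + β') := by
  refine Prod.ext ?_ ?_
  · ext i
    refine Fin.lastCases ?_ (fun i => ?_) i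
    · simp [conformal]; ring
    · simp [conformal]
  · simp [conformal]; ring

theorem smul_conformal {d : ℕ} (t : ℝ) (a : E d) (α β : ℝ) :
    t • conformal a α β = conformal (t • a) (t * α) (t * β) := by
  refine Prod.ext ?_ ?_
  · ext i
    refine Fin.lastCases ?_ (fun i => ?_) i
    · simp [conformal]; ring
    · simp [conformal]
  · simp [conformal]; ring

/-- The light ray that represents a point of `E d ∪ {∞}`. -/
def lightRay {d : ℕ} (p : OnePoint (E d)) : E (d + 1) × ℝ :=
  p.elim (conformal 0 0 1) fun x => conformal x 1 (‖x‖ ^ 2)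

theorem lightRay_infty {d : ℕ} : lightRay (∞ : OnePoint (E d)) = conformal 0 0 1 := rfl

theorem lightRay_coe {d : ℕ} (x : E d) :
    lightRay (x : OnePoint (E d)) = conformal x 1 (‖x‖ ^ 2) := rfl

theorem lorentz_lightRay_self {d : ℕ} (p : OnePoint (E d)) :
    lorentz (d + 1) (lightRay p) (lightRay p) = 0 := by
  induction p using OnePoint.rec with
  | infty => simp [lightRay_infty, lorentz_conformal]
  | coe x => simp [lightRay_coe, lorentz_conformal]

theorem conformal_eq_smul_lightRay {d : ℕ} {a : E d} {α β : ℝ}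
    (h : lorentz (d + 1) (conformal a α β) (conformal a α β) = 0) (hα : α ≠ 0) :
    conformal a α β = α • lightRay ((α⁻¹ • a : E d) : OnePoint (E d)) := by
  rw [lorentz_conformal, real_inner_self_eq_norm_sq] at h
  rw [lightRay_coe, smul_conformal, smul_smul, mul_inv_cancel₀ hα, one_smul, mul_one, norm_smul,
    mul_pow, Real.norm_eq_abs, sq_abs]
  congr 1
  field_simp
  linarith

theorem conformal_eq_smul_lightRay_infty {d : ℕ} {a : E d} {β : ℝ}
    (h : lorentz (d + 1) (conformal a 0 β) (conformal a 0 β) = 0) :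
    conformal a 0 β = β • lightRay (∞ : OnePoint (E d)) := by
  rw [lorentz_conformal, real_inner_self_eq_norm_sq] at h
  have : a = 0 := by simpa using h
  rw [lightRay_infty, smul_conformal, this]
  simp

/-! ### Lorentz reflections act as Möbius transformations -/

/-- The linear map `f` preserves the Lorentz form and acts on the light cone as a Möbius
transformation. -/
def InducesMobius {d : ℕ} (f : (E (d + 1) × ℝ) →ₗ[ℝ] (E (d + 1) × ℝ)) : Prop :=
  (∀ x y, lorentz (d + 1) (f x) (f y) = lorentz (d + 1) x y) ∧
    ∃ μ ∈ mobiusGroup d, ∀ p, ∃ t : ℝ, 0 < t ∧ f (lightRay p) = t • lightRay (μ p)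

theorem InducesMobius.id {d : ℕ} :
    InducesMobius (LinearMap.id : (E (d + 1) × ℝ) →ₗ[ℝ] (E (d + 1) × ℝ)) :=
  ⟨fun _ _ => rfl, 1, one_mem _, fun p => ⟨1, one_pos, by simp⟩⟩

theorem InducesMobius.comp {d : ℕ} {f g : (E (d + 1) × ℝ) →ₗ[ℝ] (E (d + 1) × ℝ)}
    (hf : InducesMobius f) (hg : InducesMobius g) : InducesMobius (f ∘ₗ g) := by
  obtain ⟨hf, μ, hμ, hfμ⟩ := hf
  obtain ⟨hg, ν, hν, hgν⟩ := hg
  refine ⟨fun x y => by simp [hf, hg], μ * ν, mul_mem hμ hν, fun p => ?_⟩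
  obtain ⟨t, ht, h⟩ := hgν p
  obtain ⟨t', ht', h'⟩ := hfμ (ν p)
  exact ⟨t * t', mul_pos ht ht', by simp [h, h', smul_smul]⟩

/-- A reflection that fixes the light ray of `∞` acts as a reflection in a hyperplane. -/
theorem inducesMobius_lorentzReflection_conformal_zero {d : ℕ} {a : E d} {β : ℝ} (ha : a ≠ 0) :
    InducesMobius (lorentzReflection (conformal a 0 β)) := by
  have hn : ‖a‖ ^ 2 ≠ 0 := by simpa using ha
  have hww : lorentz (d + 1) (conformal a 0 β) (conformal a 0 β) = ‖a‖ ^ 2 := by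
    simp [lorentz_conformal]
  refine ⟨lorentz_lorentzReflection (hww ▸ hn), ?_⟩
  -- The mirror `⟪a, x⟫ = β / 2` consists of the points whose light rays are orthogonal to
  -- `conformal a 0 β`; the base point is the foot of the perpendicular from the origin.
  let H : AffineSubspace ℝ (E d) := AffineSubspace.mk' ((β / 2 / ‖a‖ ^ 2) • a) (ℝ ∙ a)ᗮ
  have hH : Nonempty H := ⟨_, AffineSubspace.self_mem_mk' _ _⟩
  have hdir : H.direction = (ℝ ∙ a)ᗮ := AffineSubspace.direction_mk' _ _
  refine ⟨extendedReflection H, Subgroup.subset_closure (Or.inr ⟨H, hH, ?_, rfl⟩), fun p => ?_⟩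
  · have h1 := Submodule.finrank_add_finrank_orthogonal (ℝ ∙ a)
    rw [finrank_span_singleton ha, finrank_euclideanSpace_fin] at h1
    rw [hdir]; omega
  · refine ⟨1, one_pos, ?_⟩
    rw [one_smul, lorentzReflection_apply, hww]
    induction p using OnePoint.rec with
    | infty =>
      have : extendedReflection H ∞ = ∞ := rfl
      rw [this, lightRay_infty, lorentz_conformal]
      simp
    | coe x =>
      have h1 : extendedReflection H (x : OnePoint (E d)) =
        ((EuclideanGeometry.reflection H x : E d) : OnePoint (E d)) := rfl
      set k : ℝ := (⟪a, x⟫ - β / 2) / ‖a‖ ^ 2 with hk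
      have hx : x - k • a ∈ H := by
        rw [AffineSubspace.mem_mk', vsub_eq_sub, Submodule.mem_orthogonal_singleton_iff_inner_right]
        simp only [inner_sub_right, inner_smul_right, real_inner_self_eq_norm_sq, hk]
        field_simp
        ring
      have hv : k • a ∈ H.directionᗮ := by
        rw [hdir]
        exact Submodule.le_orthogonal_orthogonal _
          (Submodule.smul_mem _ _ (Submodule.mem_span_singleton_self a))
      have h2 := EuclideanGeometry.reflection_orthogonal_vadd hx hv
      rw [vadd_eq_add, vadd_eq_add, add_sub_cancel] at h2
      have h3 : ‖-(k • a) + (x - k • a)‖ ^ 2 = ‖x‖ ^ 2 - 2 * k * β := by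
        rw [← real_inner_self_eq_norm_sq, ← real_inner_self_eq_norm_sq]
        simp only [inner_sub_left, inner_sub_right, inner_add_left, inner_add_right,
          inner_smul_left, inner_smul_right, inner_neg_left, inner_neg_right,
          real_inner_comm x a, real_inner_self_eq_norm_sq, hk]
        simp
        field_simp
        ring
      rw [h1, h2, lightRay_coe, lightRay_coe, h3, lorentz_conformal, sub_eq_add_neg, ← neg_smul,
        smul_conformal, conformal_add]
      have h4 : 2 / ‖a‖ ^ 2 * (⟪a, x⟫ - (0 * ‖x‖ ^ 2 + 1 * β) / 2) = 2 * k := by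
        rw [hk]; ring
      rw [h4]
      congr 1
      · module
      · ring
      · ring

/-- A reflection that moves the light ray of `∞` acts as an inversion in a sphere. -/
theorem inducesMobius_lorentzReflection_conformal_one {d : ℕ} {c : E d} {β : ℝ}
    (h : 0 < lorentz (d + 1) (conformal c 1 β) (conformal c 1 β)) :
    InducesMobius (lorentzReflection (conformal c 1 β)) := by
  set w := conformal c 1 β with hw
  -- The product of `w` with the light ray of `x` is `(r ^ 2 - ‖x - c‖ ^ 2) / 2`, so `w` represents
  -- the sphere with centre `c` and radius `r`.
  obtain ⟨r, hr, hrw⟩ : ∃ r : ℝ, 0 < r ∧ r ^ 2 = lorentz (d + 1) w w :=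
    ⟨_, Real.sqrt_pos.2 h, Real.sq_sqrt h.le⟩
  have hβ : β = ‖c‖ ^ 2 - r ^ 2 := by
    rw [hrw, hw, lorentz_conformal, real_inner_self_eq_norm_sq]; ring
  have hr' := hr.ne'
  refine ⟨lorentz_lorentzReflection h.ne', sphereInversion c r hr.ne',
    Subgroup.subset_closure (Or.inl ⟨c, r, hr, rfl⟩), fun p => ?_⟩
  have hnull : lorentz (d + 1) (lorentzReflection w (lightRay p))
      (lorentzReflection w (lightRay p)) = 0 := by
    rw [lorentz_lorentzReflection h.ne', lorentz_lightRay_self]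
  induction p using OnePoint.rec with
  | infty =>
    have h1 : sphereInversion c r hr.ne' ∞ = (c : OnePoint (E d)) := rfl
    refine ⟨1 / r ^ 2, by positivity, ?_⟩
    rw [h1, lorentzReflection_apply, ← hrw, lightRay_infty, hw, lorentz_conformal, sub_eq_add_neg,
      ← neg_smul, smul_conformal, conformal_add, lightRay_coe, smul_conformal, hβ]
    congr 1
    · simp only [inner_zero_right]; module
    · simp only [inner_zero_right]; ring
    · simp only [inner_zero_right]; field_simp; ring
  | coe x =>
    have hρ : lorentz (d + 1) w (lightRay (x : OnePoint (E d))) =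
        (r ^ 2 - ‖x - c‖ ^ 2) / 2 := by
      rw [hw, lightRay_coe, lorentz_conformal, norm_sub_sq_real, real_inner_comm c x, hβ]; ring
    have h2 : lorentzReflection w (lightRay (x : OnePoint (E d))) =
        conformal (x + (‖x - c‖ ^ 2 / r ^ 2 - 1) • c) (‖x - c‖ ^ 2 / r ^ 2)
          (‖x‖ ^ 2 + (‖x - c‖ ^ 2 / r ^ 2 - 1) * β) := by
      rw [lorentzReflection_apply, hρ, ← hrw, lightRay_coe, hw, sub_eq_add_neg, ← neg_smul,
        smul_conformal, conformal_add]
      have : -(2 / r ^ 2 * ((r ^ 2 - ‖x - c‖ ^ 2) / 2)) = ‖x - c‖ ^ 2 / r ^ 2 - 1 := by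
        field_simp; ring
      rw [this]
      congr 1
      ring
    rw [h2] at hnull ⊢
    by_cases hx : x = c
    · have h1 : sphereInversion c r hr.ne' (x : OnePoint (E d)) = ∞ := if_pos hx
      refine ⟨r ^ 2, by positivity, ?_⟩
      rw [h1, lightRay_infty, smul_conformal, hx, hβ]
      congr 1 <;> simp
    · have h1 : sphereInversion c r hr.ne' (x : OnePoint (E d)) =
          ((EuclideanGeometry.inversion c r x : E d) : OnePoint (E d)) := if_neg hx
      have hd : 0 < ‖x - c‖ := norm_pos_iff.2 (sub_ne_zero.2 hx)
      have hpos : 0 < ‖x - c‖ ^ 2 / r ^ 2 := by positivity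
      refine ⟨_, hpos, ?_⟩
      rw [conformal_eq_smul_lightRay hnull hpos.ne', h1, EuclideanGeometry.inversion]
      congr 3
      simp only [vsub_eq_sub, vadd_eq_add, dist_eq_norm]
      rw [show x + (‖x - c‖ ^ 2 / r ^ 2 - 1) • c = (x - c) + (‖x - c‖ ^ 2 / r ^ 2) • c by module,
        smul_add, inv_smul_smul₀ hpos.ne', inv_div, div_pow]

/-- A reflection depends only on the line spanned by `w`, so the coordinate `α` may be taken to be
`0` (a mirror through `∞`) or `1` (a sphere). -/
theorem inducesMobius_lorentzReflection {d : ℕ} {w : E (d + 1) × ℝ}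
    (hw : 0 < lorentz (d + 1) w w) : InducesMobius (lorentzReflection w) := by
  obtain ⟨a, α, β, rfl⟩ : ∃ a α β, w = conformal a α β := ⟨_, _, _, conformal_surjective w⟩
  rcases eq_or_ne α 0 with rfl | hα
  · refine inducesMobius_lorentzReflection_conformal_zero ?_
    rintro rfl
    simp [lorentz_conformal] at hw
  · have h1 : conformal a α β = α • conformal (α⁻¹ • a) 1 (α⁻¹ * β) := by
      rw [smul_conformal, smul_smul, mul_inv_cancel₀ hα, one_smul, mul_one,
        mul_inv_cancel_left₀ hα]
    have h2 : lorentzReflection (conformal a α β) =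
        lorentzReflection (conformal (α⁻¹ • a) 1 (α⁻¹ * β)) := by
      refine LinearMap.ext fun x => ?_
      rw [h1]
      simp only [lorentzReflection_apply, map_smul, LinearMap.smul_apply, smul_eq_mul, smul_smul]
      congr 2
      field_simp
    rw [h2]
    rw [h1] at hw
    simp only [map_smul, LinearMap.smul_apply, smul_eq_mul, ← mul_assoc] at hw
    exact inducesMobius_lorentzReflection_conformal_one
      (pos_of_mul_pos_right hw (mul_self_nonneg α))

/-- Two families with the same Lorentz products are related by a map that induces a Möbius
transformation, if they begin with a future timelike vector. -/
theorem exists_inducesMobius {d n : ℕ} {b b' : Fin (n + 1) → E (d + 1) × ℝ}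
    (h : ∀ i j, lorentz (d + 1) (b i) (b j) = lorentz (d + 1) (b' i) (b' j))
    (h0 : lorentz (d + 1) (b 0) (b 0) < 0) (hb : 0 < (b 0).2) (hb' : 0 < (b' 0).2) :
    ∃ f, InducesMobius f ∧ ∀ i, f (b i) = b' i := by
  suffices H : ∀ m : ℕ, ∃ f, InducesMobius f ∧ ∀ i : Fin (n + 1), (i : ℕ) ≤ m → f (b i) = b' i by
    obtain ⟨f, hf, H⟩ := H n
    exact ⟨f, hf, fun i => H i (by omega)⟩
  intro m
  induction m with
  | zero =>
    rcases sub_eq_zero_or_lorentz_pos h0 (h 0 0).symm hb hb' with hw | hw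
    · refine ⟨_, InducesMobius.id, fun i hi => ?_⟩
      obtain rfl : i = 0 := Fin.ext (by simpa using hi)
      exact sub_eq_zero.1 hw
    · refine ⟨_, inducesMobius_lorentzReflection hw, fun i hi => ?_⟩
      obtain rfl : i = 0 := Fin.ext (by simpa using hi)
      exact lorentzReflection_sub (h 0 0) hw.ne'
  | succ m ih =>
    obtain ⟨f, hf, hfb⟩ := ih
    by_cases hm : m + 1 < n + 1
    · set k : Fin (n + 1) := ⟨m + 1, hm⟩ with hk
      -- The error `f (b k) - b' k` is orthogonal to the vectors already matched. One of them is
      -- timelike, so the error is zero or spacelike; in the latter case the reflection along it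
      -- corrects `b k` and fixes the earlier vectors.
      have horth : ∀ i : Fin (n + 1), (i : ℕ) ≤ m →
          lorentz (d + 1) (f (b k) - b' k) (b' i) = 0 := fun i hi => by
        rw [map_sub, LinearMap.sub_apply]
        nth_rewrite 1 [← hfb i hi]
        rw [hf.1, h, sub_self]
      have hlast : ∀ i : Fin (n + 1), (i : ℕ) ≤ m + 1 → (i : ℕ) ≤ m ∨ i = k := fun i hi => by
        rcases Nat.le_succ_iff.1 hi with hi | hi
        · exact Or.inl hi
        · exact Or.inr (Fin.ext hi)
      rcases eq_zero_or_lorentz_pos (h 0 0 ▸ h0)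
        ((lorentz_comm _ _).trans (horth 0 (Nat.zero_le _))) with hw | hw
      · refine ⟨f, hf, fun i hi => ?_⟩
        rcases hlast i hi with hi | rfl
        · exact hfb i hi
        · exact sub_eq_zero.1 hw
      · refine ⟨_, (inducesMobius_lorentzReflection hw).comp hf, fun i hi => ?_⟩
        rw [LinearMap.comp_apply]
        rcases hlast i hi with hi | rfl
        · rw [hfb i hi, lorentzReflection_of_orthogonal (horth i hi)]
        · exact lorentzReflection_sub (by rw [hf.1, h]) hw.ne'
    · exact ⟨f, hf, fun i _ => hfb i (by omega)⟩

/-! ### Illuminated regions -/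

/-- Starting from `x`, the squared norm along the segment has initial slope `2 * (⟪v, x⟫ - 1)` and
is convex: the segment enters the ball exactly when this slope is negative. -/
theorem mem_illuminated {n : ℕ} {v x : E n} : x ∈ illuminated v ↔ ‖x‖ = 1 ∧ 1 ≤ ⟪v, x⟫ := by
  refine and_congr_right fun hx => ?_
  have key : ∀ t : ℝ, ‖(1 - t) • x + t • v‖ ^ 2 =
      1 + 2 * t * (⟪v, x⟫ - 1) + t ^ 2 * ‖v - x‖ ^ 2 := fun t => by
    rw [show (1 - t) • x + t • v = x + t • (v - x) by module, norm_add_sq_real, hx,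
      inner_smul_right, inner_sub_right, real_inner_self_eq_norm_sq, hx, norm_smul, mul_pow,
      real_inner_comm, Real.norm_eq_abs, sq_abs]
    ring
  rw [segment_symm, Set.disjoint_left]
  constructor
  · intro h
    by_contra! hlt
    set e := 1 - ⟪v, x⟫ with he
    set D := ‖v - x‖ ^ 2 with hD
    have hD0 : 0 ≤ D := sq_nonneg _
    have he0 : 0 < e := by linarith
    -- This choice gives `t ≤ 1` and `t * D ≤ e`, so the squared norm `1 - 2 * t * e + t ^ 2 * D` is
    -- at most `1 - t * e`.
    set t : ℝ := e / (e + D) with ht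
    have hpos : 0 < e + D := by linarith
    have ht0 : 0 < t := by positivity
    have ht1 : t ≤ 1 := (div_le_one hpos).2 (by linarith)
    refine h ⟨1 - t, t, by linarith, ht0.le, by ring, rfl⟩ ?_
    rw [mem_ball_zero_iff]
    refine lt_of_pow_lt_pow_left₀ 2 zero_le_one ?_
    rw [key t]
    have h1 : t * D ≤ e := by
      rw [ht, div_mul_eq_mul_div, div_le_iff₀ hpos]; nlinarith
    have h2 : t * (t * D) ≤ t * e := mul_le_mul_of_nonneg_left h1 ht0.le
    have h3 : 0 < t * e := by positivity
    nlinarith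
  · rintro h _ ⟨a, t, ha, ht, hat, rfl⟩ hb
    obtain rfl : a = 1 - t := by linarith
    rw [mem_ball_zero_iff] at hb
    have h1 : ‖(1 - t) • x + t • v‖ ^ 2 < 1 := by
      have := norm_nonneg ((1 - t) • x + t • v)
      nlinarith
    rw [key t] at h1
    have h2 : 0 ≤ t * (⟪v, x⟫ - 1) := mul_nonneg ht (by linarith)
    have h3 : 0 ≤ t ^ 2 * ‖v - x‖ ^ 2 := by positivity
    linarith

/-- Stereographic projection is the normalization of the null vector `(x, 1)` to `α = 1` in
conformal coordinates; at the north pole `α = 0`. -/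
theorem exists_smul_lightRay_stereo {d : ℕ} {x : E (d + 1)} (hx : ‖x‖ = 1) :
    ∃ t : ℝ, 0 < t ∧ ((x, 1) : E (d + 1) × ℝ) = t • lightRay (stereo x) := by
  have hnull : lorentz (d + 1) (x, 1) (x, 1) = 0 := by
    simp [lorentz_apply, hx]
  have hle : x (Fin.last d) ≤ 1 :=
    (le_abs_self _).trans ((PiLp.norm_apply_le x (Fin.last d)).trans_eq hx)
  have hc := conformal_surjective (d := d) (x, 1)
  rw [hc] at hnull ⊢
  simp only at hnull ⊢
  by_cases h : x (Fin.last d) = 1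
  · refine ⟨2, two_pos, ?_⟩
    rw [stereo, if_pos h]
    rw [h, sub_self] at hnull ⊢
    rw [conformal_eq_smul_lightRay_infty hnull]
    norm_num
  · have h1 : 0 < 1 - x (Fin.last d) := sub_pos.2 (lt_of_le_of_ne hle h)
    refine ⟨_, h1, ?_⟩
    rw [conformal_eq_smul_lightRay hnull h1.ne', stereo, if_neg h]
    congr 3
    ext i
    simp [div_eq_inv_mul]

theorem exists_stereo_eq {d : ℕ} (p : OnePoint (E d)) :
    ∃ x : E (d + 1), ‖x‖ = 1 ∧ stereo x = p := by
  have hnull := lorentz_lightRay_self p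
  have ht : 0 < (lightRay p).2 := by
    induction p using OnePoint.rec with
    | infty => simp [lightRay_infty, conformal]
    | coe x => simp only [lightRay_coe, conformal]; positivity
  rw [lorentz_apply, real_inner_self_eq_norm_sq] at hnull
  have hn : ‖(lightRay p).1‖ = (lightRay p).2 :=
    (pow_left_inj₀ (norm_nonneg _) ht.le two_ne_zero).1 (by linarith [sq (lightRay p).2])
  refine ⟨(lightRay p).2⁻¹ • (lightRay p).1, ?_, ?_⟩
  · rw [norm_smul, hn, norm_inv, Real.norm_eq_abs, abs_of_pos ht, inv_mul_cancel₀ ht.ne']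
  · induction p using OnePoint.rec with
    | infty => simp [stereo, lightRay_infty, conformal]
    | coe x =>
      have h1 : (1 + ‖x‖ ^ 2) ≠ 0 := by positivity
      have h2 : ((lightRay (x : OnePoint (E d))).2⁻¹ • (lightRay (x : OnePoint (E d))).1)
          (Fin.last d) = 1 - 2 / (1 + ‖x‖ ^ 2) := by
        simp [lightRay_coe, conformal]
        field_simp
        ring
      rw [stereo, h2, if_neg (by simp [h1])]
      congr 1
      ext i
      simp [lightRay_coe, conformal]
      field_simp

/-- The part of `E d ∪ {∞}` on the positive side of a vector of the Lorentz space. -/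
def region {d : ℕ} (y : E (d + 1) × ℝ) : Set (OnePoint (E d)) :=
  {p | 0 ≤ lorentz (d + 1) y (lightRay p)}

theorem region_smul {d : ℕ} {t : ℝ} (ht : 0 < t) (y : E (d + 1) × ℝ) :
    region (t • y) = region y := by
  ext p
  simp [region, ht]

theorem stereo_image_illuminated {d : ℕ} (v : E (d + 1)) :
    stereo '' illuminated v = region (v, 1) := by
  have key : ∀ x : E (d + 1), ‖x‖ = 1 → (x ∈ illuminated v ↔ stereo x ∈ region (v, 1)) := by
    intro x hx
    obtain ⟨t, ht, h⟩ := exists_smul_lightRay_stereo hx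
    have h1 : lorentz (d + 1) (v, 1) (x, 1) = t * lorentz (d + 1) (v, 1) (lightRay (stereo x)) := by
      rw [h, map_smul, smul_eq_mul]
    rw [mem_illuminated, region, Set.mem_ofPred_eq, ← mul_nonneg_iff_of_pos_left ht, ← h1,
      lorentz_apply]
    simp [hx]
  ext p
  constructor
  · rintro ⟨x, hx, rfl⟩
    exact (key x hx.1).1 hx
  · intro hp
    obtain ⟨x, hx, rfl⟩ := exists_stereo_eq p
    exact ⟨x, (key x hx).2 hp, rfl⟩

theorem InducesMobius.exists_image_region {d : ℕ} {f : (E (d + 1) × ℝ) →ₗ[ℝ] (E (d + 1) × ℝ)}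
    (hf : InducesMobius f) : ∃ μ ∈ mobiusGroup d, ∀ y, μ '' region y = region (f y) := by
  obtain ⟨hf, μ, hμ, h⟩ := hf
  refine ⟨μ, hμ, fun y => ?_⟩
  have key : ∀ p, μ p ∈ region (f y) ↔ p ∈ region y := fun p => by
    obtain ⟨t, ht, hp⟩ := h p
    rw [region, region, Set.mem_ofPred_eq, Set.mem_ofPred_eq, ← hf y, hp, map_smul, smul_eq_mul,
      mul_nonneg_iff_of_pos_left ht]
  ext q
  rw [Equiv.image_eq_preimage_symm, Set.mem_preimage, ← key, Equiv.apply_symm_apply]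

/-! ### Faces of polytopes -/

/-- If a linear functional is at most `M` on `s`, then the points of the convex hull of `s` where it
takes the value `M` form the convex hull of the points of `s` where it takes the value `M`. -/
theorem mem_convexHull_of_max {n : ℕ} {s : Set (E n)} {l : StrongDual ℝ (E n)} {M : ℝ}
    (h : ∀ z ∈ s, l z ≤ M) {x : E n} (hx : x ∈ convexHull ℝ s) :
    l x < M ∨ (l x = M ∧ x ∈ convexHull ℝ {z ∈ s | l z = M}) := by
  -- The asserted alternative defines a convex set containing `s`, so it contains the hull.
  have hc : Convex ℝ {x | l x < M ∨ (l x = M ∧ x ∈ convexHull ℝ {z ∈ s | l z = M})} := by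
    intro x hx y hy a b ha hb hab
    have hx' : l x ≤ M := hx.elim le_of_lt fun h => h.1.le
    have hy' : l y ≤ M := hy.elim le_of_lt fun h => h.1.le
    have hl : l (a • x + b • y) = a * l x + b * l y := by simp
    obtain rfl : a = 1 - b := by linarith
    rcases hx with hx | hx
    · rcases ha.eq_or_lt with h0 | h0
      · obtain rfl : b = 1 := by linarith
        simpa using hy
      · left; rw [hl]; nlinarith
    · rcases hy with hy | hy
      · rcases hb.eq_or_lt with h0 | h0
        · subst h0; simpa using Or.inr hx
        · left; rw [hl]; nlinarith
      · right
        refine ⟨?_, (convex_convexHull ℝ _) hx.2 hy.2 ha hb hab⟩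
        rw [hl, hx.1, hy.1]; ring
  refine convexHull_min (fun z hz => ?_) hc hx
  rcases (h z hz).lt_or_eq with h1 | h1
  · exact Or.inl h1
  · exact Or.inr ⟨h1, subset_convexHull ℝ _ ⟨hz, h1⟩⟩

theorem le_of_mem_convexHull {n : ℕ} {s : Set (E n)} {l : StrongDual ℝ (E n)} {M : ℝ}
    (h : ∀ z ∈ s, l z ≤ M) {x : E n} (hx : x ∈ convexHull ℝ s) : l x ≤ M :=
  (mem_convexHull_of_max h hx).elim le_of_lt fun h => h.1.le

theorem isExposed_convexHull_max {n : ℕ} {s : Set (E n)} {l : StrongDual ℝ (E n)} {M : ℝ}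
    (h : ∀ z ∈ s, l z ≤ M) :
    IsExposed ℝ (convexHull ℝ s) (convexHull ℝ {z ∈ s | l z = M}) := by
  intro hne
  obtain ⟨z, hz, hzM⟩ := convexHull_nonempty_iff.1 hne
  refine ⟨l, Set.Subset.antisymm (fun x hx => ?_) fun x hx => ?_⟩
  · refine ⟨convexHull_mono (Set.sep_subset _ _) hx, fun y hy => ?_⟩
    have : M ≤ l x := by
      have := le_of_mem_convexHull (l := -l) (M := -M) (s := {z ∈ s | l z = M})
        (fun z hz => by simp [hz.2]) hx
      simpa using this
    exact (le_of_mem_convexHull h hy).trans this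
  · have h1 := hx.2 z (subset_convexHull ℝ s hz)
    rcases mem_convexHull_of_max h hx.1 with h2 | h2
    · linarith
    · exact h2.2

/-- A face of a convex hull is the convex hull of the generating points on it. -/
theorem eq_convexHull_of_isExposed {n : ℕ} {s F : Set (E n)}
    (hF : IsExposed ℝ (convexHull ℝ s) F) : F = convexHull ℝ (s ∩ F) := by
  rcases F.eq_empty_or_nonempty with rfl | ⟨x₀, hx₀⟩
  · simp
  obtain ⟨l, hl⟩ := hF ⟨x₀, hx₀⟩
  have h0 := hx₀
  rw [hl] at h0
  have hM : ∀ z ∈ s, l z ≤ l x₀ := fun z hz => h0.2 z (subset_convexHull ℝ s hz)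
  have hs : {z ∈ s | l z = l x₀} ⊆ s ∩ F := fun z hz => by
    refine ⟨hz.1, ?_⟩
    rw [hl]
    exact ⟨subset_convexHull ℝ s hz.1, fun y hy => (h0.2 y hy).trans hz.2.ge⟩
  refine Set.Subset.antisymm (fun x hx => ?_) (convexHull_min Set.inter_subset_right ?_)
  · have h1 := hx
    rw [hl] at h1
    rcases mem_convexHull_of_max hM h1.1 with h2 | h2
    · exact absurd (h1.2 x₀ h0.1) (not_le.2 h2)
    · exact convexHull_mono hs h2.2
  · exact hF.convex (convex_convexHull ℝ s)

theorem vertices_convexHull_subset {n : ℕ} (s : Set (E n)) : vertices (convexHull ℝ s) ⊆ s := by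
  intro v hv
  have h := eq_convexHull_of_isExposed hv
  have h1 : (s ∩ {v}).Nonempty := by
    rw [← convexHull_nonempty_iff (𝕜 := ℝ), ← h]; exact Set.singleton_nonempty v
  obtain ⟨w, hw, rfl⟩ := h1
  exact hw

theorem vertex_mem_of_mem_segment {n : ℕ} {P : Set (E n)} {u v w : E n} (hw : w ∈ vertices P)
    (hu : u ∈ P) (hv : v ∈ P) (h : w ∈ segment ℝ u v) : w = u ∨ w = v := by
  obtain ⟨l, hl⟩ := hw ⟨w, rfl⟩
  have hw' : w ∈ {x ∈ P | ∀ y ∈ P, l y ≤ l x} := hl ▸ rfl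
  obtain ⟨a, b, ha, hb, hab, rfl⟩ := h
  by_contra! hne
  have hlt : ∀ z ∈ P, a • u + b • v ≠ z → l z < l (a • u + b • v) := fun z hz hzne => by
    refine lt_of_le_of_ne (hw'.2 z hz) fun h => hzne ?_
    have : z ∈ {x ∈ P | ∀ y ∈ P, l y ≤ l x} := ⟨hz, fun y hy => (hw'.2 y hy).trans h.ge⟩
    rw [← hl] at this
    exact this.symm
  have h1 := hlt u hu hne.1
  have h2 := hlt v hv hne.2
  have h3 : l (a • u + b • v) = a * l u + b * l v := by simp
  have h4 := mul_nonneg ha (sub_pos.2 h1).le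
  have h5 : a * l u + b * l v = (a + b) * l (a • u + b • v) := by rw [hab, one_mul, h3]
  rcases hb.eq_or_lt with h0 | h0
  · subst h0
    obtain rfl : a = 1 := by linarith
    linarith
  · have h6 := mul_pos h0 (sub_pos.2 h2)
    linarith

/-- A polytope is the convex hull of its vertices. -/
theorem IsPolytope.eq_convexHull_vertices {n : ℕ} {P : Set (E n)} (hP : IsPolytope P) :
    P = convexHull ℝ (vertices P) := by
  obtain ⟨⟨s, hs, rfl⟩, -⟩ := hP
  have hfin : {t : Set (E n) | t ⊆ s ∧ convexHull ℝ t = convexHull ℝ s}.Finite :=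
    hs.finite_subsets.subset fun t ht => ht.1
  obtain ⟨t, ht⟩ := hfin.exists_minimal ⟨s, subset_rfl, rfl⟩
  obtain ⟨hts, htc⟩ := ht.prop
  -- `t` is a minimal generating subset. Each of its points can be separated from the hull of the
  -- others, and is therefore a vertex.
  rw [← htc]
  refine Set.Subset.antisymm (convexHull_mono fun v hv => ?_)
    (convexHull_mono (vertices_convexHull_subset t))
  have hv' : v ∉ convexHull ℝ (t \ {v}) := fun hmem => by
    have h1 : convexHull ℝ (t \ {v}) = convexHull ℝ s := by
      rw [← htc]
      refine Set.Subset.antisymm (convexHull_mono Set.sdiff_subset)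
        (convexHull_min (fun w hw => ?_) (convex_convexHull ℝ _))
      by_cases hwv : w = v
      · rwa [hwv]
      · exact subset_convexHull ℝ _ ⟨hw, hwv⟩
    have h2 := ht.le_of_le ⟨Set.sdiff_subset.trans hts, h1⟩ Set.sdiff_subset hv
    exact h2.2 rfl
  obtain ⟨l, u, hlu, huv⟩ := geometric_hahn_banach_closed_point (convex_convexHull ℝ _)
    ((hs.subset (Set.sdiff_subset.trans hts)).isClosed_convexHull (𝕜 := ℝ)) hv'
  have hlt : ∀ z ∈ t, z ≠ v → l z < l v := fun z hz hzv =>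
    (hlu z (subset_convexHull ℝ _ ⟨hz, hzv⟩)).trans huv
  have h1 := isExposed_convexHull_max (l := l) (M := l v) (s := t) fun z hz => by
    by_cases hzv : z = v
    · rw [hzv]
    · exact (hlt z hz hzv).le
  have h2 : {z ∈ t | l z = l v} = {v} := by
    ext z
    refine ⟨fun hz => ?_, fun hz => ?_⟩
    · by_contra hzv
      exact (hlt z hz.1 hzv).ne hz.2
    · obtain rfl : z = v := hz
      exact ⟨hv, rfl⟩
  rwa [h2, convexHull_singleton] at h1

theorem IsPolytope.face_eq {n : ℕ} {P F : Set (E n)} (hP : IsPolytope P) (hF : IsExposed ℝ P F) :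
    F = convexHull ℝ (vertices P ∩ F) := by
  rw [hP.eq_convexHull_vertices] at hF
  exact eq_convexHull_of_isExposed hF

/-! ### Combinatorial equivalence and vertices -/

/-- Vertices are the atoms of the face lattice: the image face is nonempty, so it contains a vertex,
whose preimage is a nonempty face inside `{v}`. -/
theorem exists_vertex_image {n m : ℕ} {P : Set (E n)} {Q : Set (E m)} (hQ : IsPolytope Q)
    (φ : Face P ≃o Face Q) {v : E n} (hv : v ∈ vertices P) :
    ∃ w ∈ vertices Q, (φ ⟨{v}, hv⟩ : Set (E m)) = {w} := by
  have he : IsExposed ℝ Q (∅ : Set (E m)) := isExposed_empty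
  have he' : IsExposed ℝ P (∅ : Set (E n)) := isExposed_empty
  have hsub : ∀ F : Face P, (φ F : Set (E m)) = ∅ → (F : Set (E n)) = ∅ := fun F hF => by
    have h1 : φ F ≤ φ ⟨∅, he'⟩ := by
      rw [← Subtype.coe_le_coe, hF]; exact Set.empty_subset _
    exact Set.subset_empty_iff.1 (φ.le_iff_le.1 h1)
  have hne : (φ ⟨{v}, hv⟩ : Set (E m)) ≠ ∅ := fun h =>
    Set.singleton_ne_empty v (hsub _ h)
  have hf := hQ.face_eq (φ ⟨{v}, hv⟩).2
  obtain ⟨w, hw, hwF⟩ : (vertices Q ∩ (φ ⟨{v}, hv⟩ : Set (E m))).Nonempty := by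
    rw [← convexHull_nonempty_iff (𝕜 := ℝ), ← hf]; exact Set.nonempty_iff_ne_empty.2 hne
  refine ⟨w, hw, ?_⟩
  have h1 : φ.symm ⟨{w}, hw⟩ ≤ ⟨{v}, hv⟩ := by
    rw [φ.symm_apply_le]; exact Set.singleton_subset_iff.2 hwF
  rcases Set.subset_singleton_iff_eq.1 h1 with h2 | h2
  · have h3 : φ.symm ⟨{w}, hw⟩ ≤ φ.symm ⟨∅, he⟩ := by
      rw [← Subtype.coe_le_coe, h2]; exact Set.empty_subset _
    exact absurd (φ.symm.le_iff_le.1 h3 (rfl : w ∈ ({w} : Set (E m)))) (Set.notMem_empty w)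
  · have h3 : φ.symm ⟨{w}, hw⟩ = ⟨{v}, hv⟩ := Subtype.ext h2
    rw [← h3, φ.apply_symm_apply]

/-- An isomorphism of face lattices is given by a bijection of the vertices. -/
theorem CombEquiv.exists_bijOn {n m : ℕ} {P : Set (E n)} {Q : Set (E m)} (hP : IsPolytope P)
    (hQ : IsPolytope Q) (h : CombEquiv P Q) :
    ∃ ψ : E n → E m, Set.BijOn ψ (vertices P) (vertices Q) ∧
      ∀ F, IsExposed ℝ P F → IsExposed ℝ Q (convexHull ℝ (ψ '' (vertices P ∩ F))) ∧
        (F ≠ P → convexHull ℝ (ψ '' (vertices P ∩ F)) ≠ Q) := by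
  obtain ⟨φ⟩ := h
  choose! ψ hψ hφ using fun v (hv : v ∈ vertices P) => exists_vertex_image hQ φ hv
  have hψ' : ∀ v (hv : v ∈ vertices P), φ ⟨{v}, hv⟩ = ⟨{ψ v}, hψ v hv⟩ := fun v hv =>
    Subtype.ext (hφ v hv)
  have hsurj : Set.SurjOn ψ (vertices P) (vertices Q) := fun w hw => by
    obtain ⟨v, hv, h⟩ := exists_vertex_image hP φ.symm hw
    have h1 : φ.symm ⟨{w}, hw⟩ = ⟨{v}, hv⟩ := Subtype.ext h
    refine ⟨v, hv, ?_⟩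
    have h2 := hψ' v hv
    rw [← h1, φ.apply_symm_apply] at h2
    exact (Set.singleton_injective (congrArg Subtype.val h2)).symm
  refine ⟨ψ, ⟨hψ, fun u hu v hv huv => ?_, hsurj⟩, fun F hF => ?_⟩
  · have : φ ⟨{u}, hu⟩ = φ ⟨{v}, hv⟩ := by
      exact Subtype.ext ((hφ u hu).trans ((congrArg _ huv).trans (hφ v hv).symm))
    exact Set.singleton_injective (congrArg Subtype.val (φ.injective this))
  · have hmem : ∀ v, v ∈ vertices P → (v ∈ F ↔ ψ v ∈ (φ ⟨F, hF⟩ : Set (E m))) := fun v hv => by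
      have h1 : (⟨{v}, hv⟩ : Face P) ≤ ⟨F, hF⟩ ↔ v ∈ F := Set.singleton_subset_iff
      have h2 : (⟨{ψ v}, hψ v hv⟩ : Face Q) ≤ φ ⟨F, hF⟩ ↔ ψ v ∈ (φ ⟨F, hF⟩ : Set (E m)) :=
        Set.singleton_subset_iff
      rw [← h1, ← h2, ← hψ' v hv, φ.le_iff_le]
    have himg : ψ '' (vertices P ∩ F) = vertices Q ∩ (φ ⟨F, hF⟩ : Set (E m)) := by
      ext w
      constructor
      · rintro ⟨v, ⟨hv, hvF⟩, rfl⟩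
        exact ⟨hψ v hv, (hmem v hv).1 hvF⟩
      · rintro ⟨hw, hwF⟩
        obtain ⟨v, hv, rfl⟩ := hsurj hw
        exact ⟨v, ⟨hv, (hmem v hv).2 hwF⟩, rfl⟩
    rw [himg, ← hQ.face_eq (φ ⟨F, hF⟩).2]
    refine ⟨(φ ⟨F, hF⟩).2, fun hne heq => hne ?_⟩
    have h1 : φ ⟨P, IsExposed.refl P⟩ ≤ φ ⟨F, hF⟩ := by
      rw [← Subtype.coe_le_coe, heq]; exact (φ ⟨P, IsExposed.refl P⟩).2.subset
    exact Set.Subset.antisymm hF.subset (φ.le_iff_le.1 h1)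

/-- The functional `⟪a - b, ·⟫` exposes `a` in the segment. The segment is the hull of the vertices
of `P` on it, and a vertex of a hull is one of the generators. -/
theorem IsPolytope.left_mem_vertices {n : ℕ} {P : Set (E n)} (hP : IsPolytope P) {a b : E n}
    (h : IsExposed ℝ P (segment ℝ a b)) (hab : a ≠ b) : a ∈ vertices P := by
  have hseg : a ∈ vertices (segment ℝ a b) := by
    intro _
    have key : ∀ s t : ℝ, s + t = 1 → ⟪a - b, a⟫ - ⟪a - b, s • a + t • b⟫ = t * ‖a - b‖ ^ 2 := by
      intro s t hst
      obtain rfl : s = 1 - t := by linarith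
      rw [← inner_sub_right, ← real_inner_self_eq_norm_sq, ← real_inner_smul_right]
      congr 1
      module
    have hpos : 0 < ‖a - b‖ ^ 2 := by
      have := norm_pos_iff.2 (sub_ne_zero.2 hab)
      positivity
    refine ⟨innerSL ℝ (a - b), Set.Subset.antisymm ?_ ?_⟩
    · rintro _ rfl
      refine ⟨left_mem_segment ℝ _ b, ?_⟩
      rintro _ ⟨s, t, hs, ht, hst, rfl⟩
      rw [innerSL_apply_apply, innerSL_apply_apply]
      linarith [key s t hst, mul_nonneg ht hpos.le]
    · rintro _ ⟨⟨s, t, hs, ht, hst, rfl⟩, hmax⟩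
      have h1 := hmax a (left_mem_segment ℝ _ b)
      rw [innerSL_apply_apply, innerSL_apply_apply] at h1
      have h2 : t * ‖a - b‖ ^ 2 ≤ 0 := by linarith [key s t hst]
      obtain rfl : t = 0 := le_antisymm (nonpos_of_mul_nonpos_left h2 hpos) ht
      obtain rfl : s = 1 := by linarith
      simp
  rw [hP.face_eq h] at hseg
  exact (vertices_convexHull_subset _ hseg).1

theorem isExposed_image {n : ℕ} (e : E n ≃L[ℝ] E n) {P F : Set (E n)}
    (hF : IsExposed ℝ P F) : IsExposed ℝ (e '' P) (e '' F) := by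
  rintro ⟨_, x, hx, rfl⟩
  obtain ⟨l, hl⟩ := hF ⟨x, hx⟩
  refine ⟨l.comp (e.symm : E n →L[ℝ] E n), ?_⟩
  ext y
  obtain ⟨y, rfl⟩ := e.surjective y
  rw [e.injective.mem_set_image]
  conv_lhs => rw [hl]
  simp

/-- A linear automorphism preserves the combinatorial type. -/
theorem combEquiv_image {n : ℕ} (e : E n ≃L[ℝ] E n) (P : Set (E n)) : CombEquiv P (e '' P) := by
  refine ⟨⟨⟨fun F => ⟨e '' F, isExposed_image e F.2⟩, fun F => ⟨e.symm '' F, ?_⟩, fun F => ?_, fun F => ?_⟩,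
    ?_⟩⟩
  · simpa [Set.image_image] using isExposed_image e.symm F.2
  · exact Subtype.ext (by simp [Set.image_image])
  · exact Subtype.ext (by simp [Set.image_image])
  · intro F G
    exact Set.image_subset_image_iff e.injective

/-! ### Octahedra in the Lorentz space -/

theorem finrank_lorentzSpace (n : ℕ) : Module.finrank ℝ (E n × ℝ) = n + 1 := by
  rw [Module.finrank_prod, finrank_euclideanSpace_fin, Module.finrank_self]

/-- Two unit vectors whose products with a triangle of pairwise tangent unit vectors are `-1` and
whose difference is lightlike coincide. -/
theorem eq_of_lorentz_sub_self_eq_zero {n : ℕ} {p q u v : E n × ℝ} (hp : lorentz n p p = 1)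
    (hu : lorentz n u u = 1) (hv : lorentz n v v = 1) (hpu : lorentz n p u = -1)
    (hpv : lorentz n p v = -1) (huv : lorentz n u v = -1) (hqu : lorentz n q u = -1)
    (hqv : lorentz n q v = -1) (h : lorentz n (p - q) (p - q) = 0) (hq : lorentz n q q = 1) :
    p = q := by
  have h1 : lorentz n ((p + u) + (p + v)) ((p + u) + (p + v)) < 0 := by
    simp only [map_add, LinearMap.add_apply, lorentz_comm u p, lorentz_comm v p, lorentz_comm v u,
      hp, hu, hv, hpu, hpv, huv]
    norm_num
  have h2 : lorentz n ((p + u) + (p + v)) (p - q) = 0 := by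
    simp only [map_sub, LinearMap.sub_apply, lorentz_comm q p, hp, hq] at h
    simp only [map_add, map_sub, LinearMap.add_apply, lorentz_comm u p, lorentz_comm v p,
      lorentz_comm u q, lorentz_comm v q, hp, hpu, hpv, hqu, hqv]
    linarith
  rcases eq_zero_or_lorentz_pos h1 h2 with h3 | h3
  · exact sub_eq_zero.1 h3
  · exact absurd h h3.ne'

/-- Rigidity of the octahedron: six unit vectors in a hyperplane, arranged in three pairs, such that
vectors of different pairs have product `-1`. -/
theorem octahedron_rigid {n : ℕ} (hn : n = 4) {p q : Fin 3 → E n × ℝ}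
    {ℓ : (E n × ℝ) →ₗ[ℝ] ℝ} (hℓ : ℓ ≠ 0) (hpℓ : ∀ i, ℓ (p i) = 0) (hqℓ : ∀ i, ℓ (q i) = 0)
    (hp : ∀ i, lorentz n (p i) (p i) = 1) (hq : ∀ i, lorentz n (q i) (q i) = 1)
    (hpp : ∀ i j, i ≠ j → lorentz n (p i) (p j) = -1)
    (hpq : ∀ i j, i ≠ j → lorentz n (p i) (q j) = -1)
    (hqq : ∀ i j, i ≠ j → lorentz n (q i) (q j) = -1) (hne : ∀ i, p i ≠ q i) :
    p 0 + q 0 = p 1 + q 1 ∧ lorentz n (p 0) (q 0) = -3 := by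
  have hqp : ∀ i j, i ≠ j → lorentz n (q i) (p j) = -1 := fun i j hij => by
    rw [lorentz_comm, hpq j i hij.symm]
  set D : Fin 3 → E n × ℝ := fun i => p i - q i with hD
  set s : Fin 3 → E n × ℝ := fun i => p i + q i with hs
  have hDs : ∀ i j, lorentz n (D i) (s j) = 0 := fun i j => by
    simp only [hD, hs, map_add, map_sub, LinearMap.sub_apply]
    rcases eq_or_ne i j with rfl | hij
    · rw [hp, hq, lorentz_comm (q i) (p i)]; ring
    · rw [hpp i j hij, hpq i j hij, hqp i j hij, hqq i j hij]; ring
  have hDD : ∀ i j, i ≠ j → lorentz n (D i) (D j) = 0 := fun i j hij => by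
    simp only [hD, map_sub, LinearMap.sub_apply]
    rw [hpp i j hij, hpq i j hij, hqp i j hij, hqq i j hij]; ring
  have hss : ∀ i j, i ≠ j → lorentz n (s i) (s j) = -4 := fun i j hij => by
    simp only [hs, map_add, LinearMap.add_apply]
    rw [hpp i j hij, hpq i j hij, hqp i j hij, hqq i j hij]; ring
  have hDne : ∀ i, lorentz n (D i) (D i) ≠ 0 := fun i h => by
    obtain ⟨j, k, hij, hik, hjk⟩ : ∃ j k : Fin 3, i ≠ j ∧ i ≠ k ∧ j ≠ k := by
      clear * -
      revert i; decide
    exact hne i (eq_of_lorentz_sub_self_eq_zero (hp i) (hp j) (hp k) (hpp i j hij) (hpp i k hik)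
      (hpp j k hjk) (hqp i j hij) (hqp i k hik) h (hq i))
  -- Five independent vectors in the kernel of `ℓ` would span the whole space and force `ℓ = 0`.
  have hdep : ¬ LinearIndependent ℝ ![D 0, D 1, D 2, s 0, s 1] := fun hli => by
    refine hℓ ?_
    have hspan := hli.span_eq_top_of_card_eq_finrank (by rw [finrank_lorentzSpace, hn]; rfl)
    refine LinearMap.ext_on hspan ?_
    rintro _ ⟨i, rfl⟩
    fin_cases i <;> simp [hD, hs, hpℓ, hqℓ]
  rw [Fintype.not_linearIndependent_iff] at hdep
  obtain ⟨g, hg, hgne⟩ := hdep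
  simp only [Fin.sum_univ_five] at hg
  change g 0 • D 0 + g 1 • D 1 + g 2 • D 2 + g 3 • s 0 + g 4 • s 1 = 0 at hg
  have hpair : ∀ y, g 0 * lorentz n y (D 0) + g 1 * lorentz n y (D 1) + g 2 * lorentz n y (D 2) +
      g 3 * lorentz n y (s 0) + g 4 * lorentz n y (s 1) = 0 := fun y => by
    have := congrArg (lorentz n y) hg
    simpa only [map_add, map_smul, smul_eq_mul, map_zero] using this
  have g0 : g 0 = 0 := by
    have := hpair (D 0)
    rw [hDD 0 1 (by decide), hDD 0 2 (by decide), hDs, hDs] at this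
    simpa [hDne 0] using this
  have g1 : g 1 = 0 := by
    have := hpair (D 1)
    rw [hDD 1 0 (by decide), hDD 1 2 (by decide), hDs, hDs] at this
    simpa [hDne 1] using this
  have g2 : g 2 = 0 := by
    have := hpair (D 2)
    rw [hDD 2 0 (by decide), hDD 2 1 (by decide), hDs, hDs] at this
    simpa [hDne 2] using this
  -- Pairing with the third sum `s 2` detects both remaining coefficients with the same weight `-4`.
  have g34 : g 4 = - g 3 := by
    have := hpair (s 2)
    rw [g0, g1, g2, hss 2 0 (by decide), hss 2 1 (by decide)] at this
    linarith
  have g3 : g 3 ≠ 0 := fun h3 => by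
    obtain ⟨i, hi⟩ := hgne
    rw [h3, neg_zero] at g34
    fin_cases i <;> contradiction
  have h01 : s 0 = s 1 := by
    rw [g0, g1, g2, g34] at hg
    have : g 3 • (s 0 - s 1) = 0 := by rw [← hg]; module
    exact sub_eq_zero.1 ((smul_eq_zero.1 this).resolve_left g3)
  refine ⟨h01, ?_⟩
  have h1 := hss 0 1 (by decide)
  rw [← h01] at h1
  simp only [hs, map_add, LinearMap.add_apply] at h1
  rw [hp, hq, lorentz_comm (q 0)] at h1
  linarith

/-! ### Configurations with the combinatorics of the 24-cell

The vertices of the 24-cell are labelled by the integral vectors of squared norm `2`. Two vertices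
are adjacent if their product is `1`, and the facets are labelled by the integral vectors `S` of
squared norm `4`, which is the sum of any two opposite vertices of the facet. -/

/-- The lifts to the Lorentz space, normalized to be unit vectors, of the vertices of an
edge-scribed polytope with the combinatorics of the 24-cell. -/
structure IsConfiguration (x : (Fin 4 → ℤ) → E 4 × ℝ) : Prop where
  norm : ∀ z, z ⬝ᵥ z = 2 → lorentz 4 (x z) (x z) = 1
  future : ∀ z, z ⬝ᵥ z = 2 → 0 < (x z).2
  adjacent : ∀ u v, u ⬝ᵥ u = 2 → v ⬝ᵥ v = 2 → u ⬝ᵥ v = 1 → lorentz 4 (x u) (x v) = -1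
  inj : ∀ u v, u ⬝ᵥ u = 2 → v ⬝ᵥ v = 2 → x u = x v → u = v
  facet : ∀ S, S ⬝ᵥ S = 4 → ∃ ℓ : (E 4 × ℝ) →ₗ[ℝ] ℝ, ℓ ≠ 0 ∧
    ∀ z, z ⬝ᵥ z = 2 → S ⬝ᵥ z = 2 → ℓ (x z) = 0

/-- The labels `u`, `v` and `w` form a triangle in the facet `S`. -/
def IsTriangle (S u v w : Fin 4 → ℤ) : Prop :=
  (u ⬝ᵥ u = 2 ∧ v ⬝ᵥ v = 2 ∧ w ⬝ᵥ w = 2) ∧ (u ⬝ᵥ v = 1 ∧ u ⬝ᵥ w = 1 ∧ v ⬝ᵥ w = 1) ∧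
    S ⬝ᵥ S = 4 ∧ S ⬝ᵥ u = 2 ∧ S ⬝ᵥ v = 2 ∧ S ⬝ᵥ w = 2

instance (S u v w : Fin 4 → ℤ) : Decidable (IsTriangle S u v w) := by
  unfold IsTriangle; infer_instance

/-- The triangle and the labels `S - u`, `S - v`, `S - w` form an octahedron in the facet `S`, to
which `octahedron_rigid` applies. -/
theorem IsConfiguration.opposite {x : (Fin 4 → ℤ) → E 4 × ℝ} (hx : IsConfiguration x)
    {S u v w : Fin 4 → ℤ} (h : IsTriangle S u v w) :
    x u + x (S - u) = x v + x (S - v) ∧ lorentz 4 (x u) (x (S - u)) = -3 := by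
  obtain ⟨⟨hu, hv, hw⟩, ⟨huv, huw, hvw⟩, hS, hSu, hSv, hSw⟩ := h
  obtain ⟨ℓ, hℓ, hℓx⟩ := hx.facet S hS
  set z : Fin 3 → Fin 4 → ℤ := ![u, v, w] with hz
  have hzz : ∀ i, z i ⬝ᵥ z i = 2 := by
    intro i; fin_cases i <;> assumption
  have hSz : ∀ i, S ⬝ᵥ z i = 2 := by
    intro i; fin_cases i <;> assumption
  have hzS : ∀ i, z i ⬝ᵥ S = 2 := fun i => by rw [dotProduct_comm, hSz]
  have hzij : ∀ i j, i ≠ j → z i ⬝ᵥ z j = 1 := by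
    intro i j hij
    fin_cases i <;> fin_cases j <;>
      first
      | exact absurd rfl hij
      | assumption
      | (rw [dotProduct_comm]; assumption)
  have hopp : ∀ i, (S - z i) ⬝ᵥ (S - z i) = 2 := fun i => by
    rw [sub_dotProduct, dotProduct_sub, dotProduct_sub, hS, hSz, hzS, hzz]; norm_num
  refine octahedron_rigid rfl (p := fun i => x (z i)) (q := fun i => x (S - z i)) hℓ
    (fun i => hℓx _ (hzz i) (hSz i)) (fun i => hℓx _ (hopp i) ?_) (fun i => hx.norm _ (hzz i))
    (fun i => hx.norm _ (hopp i)) (fun i j hij => hx.adjacent _ _ (hzz i) (hzz j) (hzij i j hij))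
    (fun i j hij => hx.adjacent _ _ (hzz i) (hopp j) ?_)
    (fun i j hij => hx.adjacent _ _ (hopp i) (hopp j) ?_) (fun i h => ?_)
  · rw [dotProduct_sub, hS, hSz]; norm_num
  · rw [dotProduct_sub, hzS, hzij i j hij]; norm_num
  · rw [sub_dotProduct, dotProduct_sub, dotProduct_sub, hS, hSz, hzS, hzij i j hij]; norm_num
  · have h1 := hx.inj _ _ (hzz i) (hopp i) h
    have h2 := hSz i
    have h3 := hzz i
    rw [h1, dotProduct_sub, hS, hSz] at h2
    have h4 : z i ⬝ᵥ (S - z i) = z i ⬝ᵥ z i := by rw [← h1]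
    rw [dotProduct_sub, hzS, hzz] at h4
    norm_num at h4

/-- The labels of the vertices of the 24-cell have coordinates in `{-1, 0, 1}`. -/
theorem mem_piFinset_of_dotProduct_self {z : Fin 4 → ℤ} (hz : z ⬝ᵥ z = 2) :
    z ∈ Fintype.piFinset fun _ : Fin 4 => ({-1, 0, 1} : Finset ℤ) := by
  rw [Fintype.mem_piFinset]
  intro i
  have h : z i * z i ≤ 2 := hz ▸ Finset.single_le_sum (f := fun i => z i * z i)
    (fun j _ => mul_self_nonneg (z j)) (Finset.mem_univ i)
  have h1 : -1 ≤ z i := by nlinarith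
  have h2 : z i ≤ 1 := by nlinarith
  have : z i = -1 ∨ z i = 0 ∨ z i = 1 := by omega
  simpa using this

theorem IsConfiguration.lorentz_opposite {x : (Fin 4 → ℤ) → E 4 × ℝ} (hx : IsConfiguration x)
    {u u' v w : Fin 4 → ℤ} (h : IsTriangle (u + u') u v w) : lorentz 4 (x u) (x u') = -3 := by
  simpa using (hx.opposite h).2

/-- The Lorentz products of vectors `p₁`, `p₂`, `p₃` that are pairwise opposite in octahedra around
the edge with the end points `u` and `v`. -/
theorem gram_edge {n : ℕ} {p₁ p₂ p₃ u v : E n × ℝ} (h₁ : lorentz n p₁ p₁ = 1)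
    (h₂ : lorentz n p₂ p₂ = 1) (h₃ : lorentz n p₃ p₃ = 1) (hu : lorentz n u u = 1)
    (hv : lorentz n v v = 1) (h₁₂ : lorentz n p₁ p₂ = -3) (h₁₃ : lorentz n p₁ p₃ = -3)
    (h₂₃ : lorentz n p₂ p₃ = -3) (h₁u : lorentz n p₁ u = -1) (h₂u : lorentz n p₂ u = -1)
    (h₃u : lorentz n p₃ u = -1) (h₁v : lorentz n p₁ v = -1) (h₂v : lorentz n p₂ v = -1)
    (h₃v : lorentz n p₃ v = -1) (huv : lorentz n u v = -1) (i j : Fin 5) :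
    lorentz n (![p₁ + p₂, p₁, u, v, p₃] i) (![p₁ + p₂, p₁, u, v, p₃] j) =
      (!![-4, -2, -2, -2, -6; -2, 1, -1, -1, -3; -2, -1, 1, -1, -1; -2, -1, -1, 1, -1;
        -6, -3, -1, -1, 1] : Matrix (Fin 5) (Fin 5) ℝ) i j := by
  have g₁₂ := (lorentz_comm p₂ p₁).trans h₁₂
  have g₁₃ := (lorentz_comm p₃ p₁).trans h₁₃
  have g₂₃ := (lorentz_comm p₃ p₂).trans h₂₃
  have g₁u := (lorentz_comm u p₁).trans h₁u
  have g₂u := (lorentz_comm u p₂).trans h₂u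
  have g₃u := (lorentz_comm u p₃).trans h₃u
  have g₁v := (lorentz_comm v p₁).trans h₁v
  have g₂v := (lorentz_comm v p₂).trans h₂v
  have g₃v := (lorentz_comm v p₃).trans h₃v
  have guv := (lorentz_comm v u).trans huv
  fin_cases i <;> fin_cases j <;> simp [*] <;> norm_num

/-- The edge joins `![1, 1, 0, 0]` and `![1, 0, 1, 0]`; the other three labels are pairwise opposite
in the octahedra around it. The sum of two of them comes first because its square `-4` supplies the
timelike vector that `exists_inducesMobius` needs. -/
theorem IsConfiguration.gram_flag {x : (Fin 4 → ℤ) → E 4 × ℝ} (hx : IsConfiguration x)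
    (i j : Fin 5) :
    lorentz 4 (![x ![1, 0, 0, 1] + x ![1, 0, 0, -1], x ![1, 0, 0, 1], x ![1, 1, 0, 0],
          x ![1, 0, 1, 0], x ![0, 1, 1, 0]] i)
        (![x ![1, 0, 0, 1] + x ![1, 0, 0, -1], x ![1, 0, 0, 1], x ![1, 1, 0, 0],
          x ![1, 0, 1, 0], x ![0, 1, 1, 0]] j) =
      (!![-4, -2, -2, -2, -6; -2, 1, -1, -1, -3; -2, -1, 1, -1, -1; -2, -1, -1, 1, -1;
        -6, -3, -1, -1, 1] : Matrix (Fin 5) (Fin 5) ℝ) i j := by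
  have hn := hx.norm
  have ha := hx.adjacent
  exact gram_edge (hn _ (by decide)) (hn _ (by decide)) (hn _ (by decide)) (hn _ (by decide))
    (hn _ (by decide))
    (hx.lorentz_opposite (v := ![1, 1, 0, 0]) (w := ![1, 0, 1, 0]) (by decide))
    (hx.lorentz_opposite (v := ![1, 1, 0, 0]) (w := ![1, 0, 1, 0]) (by decide))
    (hx.lorentz_opposite (v := ![1, 1, 0, 0]) (w := ![1, 0, 1, 0]) (by decide))
    (ha _ _ (by decide) (by decide) (by decide)) (ha _ _ (by decide) (by decide) (by decide))
    (ha _ _ (by decide) (by decide) (by decide)) (ha _ _ (by decide) (by decide) (by decide))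
    (ha _ _ (by decide) (by decide) (by decide)) (ha _ _ (by decide) (by decide) (by decide))
    (ha _ _ (by decide) (by decide) (by decide)) i j

theorem IsConfiguration.exists_inducesMobius {x x' : (Fin 4 → ℤ) → E 4 × ℝ}
    (hx : IsConfiguration x) (hx' : IsConfiguration x') :
    ∃ f : (E (3 + 1) × ℝ) →ₗ[ℝ] (E (3 + 1) × ℝ), InducesMobius f ∧
      ∀ z, z ⬝ᵥ z = 2 → f (x z) = x' z := by
  obtain ⟨f, hf, hb⟩ := MobiusPolytope.exists_inducesMobius (d := 3)
    (fun i j => (hx.gram_flag i j).trans (hx'.gram_flag i j).symm)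
    ((hx.gram_flag 0 0).trans_lt (by norm_num))
    (add_pos (hx.future _ (by decide)) (hx.future _ (by decide)))
    (add_pos (hx'.future _ (by decide)) (hx'.future _ (by decide)))
  refine ⟨f, hf, ?_⟩
  -- If `a`, `b` and `c`, `t` are opposite pairs of one octahedron, equality of their sums
  -- determines the fourth lift linearly; `w` completes a triangle in that facet.
  have step : ∀ {a b c t : Fin 4 → ℤ} (w), f (x a) = x' a → f (x b) = x' b → f (x c) = x' c →
      (IsTriangle (a + b) a c w ∧ a + b - c = t) → f (x t) = x' t := by
    rintro a b c t w ha hb hc ⟨h, rfl⟩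
    have h1 := (hx.opposite h).1
    have h2 := (hx'.opposite h).1
    rw [add_sub_cancel_left] at h1 h2
    rw [eq_sub_of_add_eq' h1.symm, eq_sub_of_add_eq' h2.symm, map_sub, map_add, ha, hb, hc]
  -- The letters `p`, `o`, `m` in these names stand for the coordinates `1`, `0`, `-1`.
  have hpoop : f (x ![1, 0, 0, 1]) = x' ![1, 0, 0, 1] := hb 1
  have hppoo : f (x ![1, 1, 0, 0]) = x' ![1, 1, 0, 0] := hb 2
  have hpopo : f (x ![1, 0, 1, 0]) = x' ![1, 0, 1, 0] := hb 3
  have hoppo : f (x ![0, 1, 1, 0]) = x' ![0, 1, 1, 0] := hb 4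
  have hpoom : f (x ![1, 0, 0, -1]) = x' ![1, 0, 0, -1] := by
    have h0 : f (x ![1, 0, 0, 1] + x ![1, 0, 0, -1]) = x' ![1, 0, 0, 1] + x' ![1, 0, 0, -1] := hb 0
    rw [map_add, hpoop] at h0
    exact add_left_cancel h0
  have hpmoo : f (x ![1, -1, 0, 0]) = x' ![1, -1, 0, 0] :=
    step ![1, 0, 1, 0] hpoop hpoom hppoo (by decide)
  have hpomo : f (x ![1, 0, -1, 0]) = x' ![1, 0, -1, 0] :=
    step ![1, 0, 0, 1] hppoo hpmoo hpopo (by decide)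
  have hoopp : f (x ![0, 0, 1, 1]) = x' ![0, 0, 1, 1] :=
    step ![1, 0, 1, 0] hpoop hoppo hppoo (by decide)
  have hopop : f (x ![0, 1, 0, 1]) = x' ![0, 1, 0, 1] :=
    step ![1, 0, 0, 1] hppoo hoopp hpopo (by decide)
  have hoopm : f (x ![0, 0, 1, -1]) = x' ![0, 0, 1, -1] :=
    step ![1, 0, 1, 0] hpoom hoppo hppoo (by decide)
  have hopom : f (x ![0, 1, 0, -1]) = x' ![0, 1, 0, -1] :=
    step ![1, 0, 0, -1] hppoo hoopm hpopo (by decide)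
  have homop : f (x ![0, -1, 0, 1]) = x' ![0, -1, 0, 1] :=
    step ![1, 0, 0, 1] hpmoo hoopp hpopo (by decide)
  have hompo : f (x ![0, -1, 1, 0]) = x' ![0, -1, 1, 0] :=
    step ![1, -1, 0, 0] hpopo homop hpoop (by decide)
  have homom : f (x ![0, -1, 0, -1]) = x' ![0, -1, 0, -1] :=
    step ![1, -1, 0, 0] hpoom hompo hpopo (by decide)
  have hmopo : f (x ![-1, 0, 1, 0]) = x' ![-1, 0, 1, 0] :=
    step ![0, 0, 1, 1] hoppo hompo hpopo (by decide)
  have hoomp : f (x ![0, 0, -1, 1]) = x' ![0, 0, -1, 1] :=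
    step ![1, 0, 0, 1] hpomo hopop hppoo (by decide)
  have hopmo : f (x ![0, 1, -1, 0]) = x' ![0, 1, -1, 0] :=
    step ![1, 0, -1, 0] hppoo hoomp hpoop (by decide)
  have hoomm : f (x ![0, 0, -1, -1]) = x' ![0, 0, -1, -1] :=
    step ![1, 0, -1, 0] hpoom hopmo hppoo (by decide)
  have hmpoo : f (x ![-1, 1, 0, 0]) = x' ![-1, 1, 0, 0] :=
    step ![0, 1, 0, 1] hoppo hopmo hppoo (by decide)
  have hommo : f (x ![0, -1, -1, 0]) = x' ![0, -1, -1, 0] :=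
    step ![1, 0, -1, 0] hpmoo hoomp hpoop (by decide)
  have hmoop : f (x ![-1, 0, 0, 1]) = x' ![-1, 0, 0, 1] :=
    step ![0, 1, 0, 1] hoopp hoomp hpoop (by decide)
  have hmoom : f (x ![-1, 0, 0, -1]) = x' ![-1, 0, 0, -1] :=
    step ![0, 1, 0, -1] hoopm hoomm hpoom (by decide)
  have hmmoo : f (x ![-1, -1, 0, 0]) = x' ![-1, -1, 0, 0] :=
    step ![0, -1, 1, 0] homop homom hpmoo (by decide)
  have hmomo : f (x ![-1, 0, -1, 0]) = x' ![-1, 0, -1, 0] :=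
    step ![0, 1, -1, 0] hoomp hoomm hpomo (by decide)
  intro z hz
  have hmem := mem_piFinset_of_dotProduct_self hz
  rw [Fintype.mem_piFinset] at hmem
  obtain ⟨a, b, c, e, rfl⟩ : ∃ a b c e, z = ![a, b, c, e] :=
    ⟨z 0, z 1, z 2, z 3, by ext i; fin_cases i <;> rfl⟩
  have ha := hmem 0
  have hb := hmem 1
  have hc := hmem 2
  have he := hmem 3
  simp only [Finset.mem_insert, Finset.mem_singleton, Matrix.cons_val] at ha hb hc he
  rcases ha with rfl | rfl | rfl <;> rcases hb with rfl | rfl | rfl <;>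
    rcases hc with rfl | rfl | rfl <;> rcases he with rfl | rfl | rfl <;>
    first
    | assumption
    | exact absurd hz (by decide)

/-! ### The faces of the 24-cell -/

/-- The point of `E 4` with the given integral coordinates. -/
def latticePoint (z : Fin 4 → ℤ) : E 4 := WithLp.toLp 2 fun i => (z i : ℝ)

theorem inner_latticePoint (u v : Fin 4 → ℤ) :
    ⟪latticePoint u, latticePoint v⟫ = ((u ⬝ᵥ v : ℤ) : ℝ) := by
  simp [latticePoint, PiLp.inner_apply, dotProduct, mul_comm]

theorem latticePoint_add (u v : Fin 4 → ℤ) :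
    latticePoint (u + v) = latticePoint u + latticePoint v := by
  ext i; simp [latticePoint]

theorem latticePoint_sub (u v : Fin 4 → ℤ) :
    latticePoint (u - v) = latticePoint u - latticePoint v := by
  ext i; simp [latticePoint]

theorem latticePoint_injective : Function.Injective latticePoint := fun u v h => by
  ext i
  simpa [latticePoint] using congrArg (fun x : E 4 => x i) h

/-- The labels of the vertices of the 24-cell. -/
def roots : Set (Fin 4 → ℤ) := {z | z ⬝ᵥ z = 2}

theorem mem_roots {z : Fin 4 → ℤ} : z ∈ roots ↔ z ⬝ᵥ z = 2 := Iff.rfl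

theorem finite_roots : roots.Finite :=
  (Finset.finite_toSet _).subset fun _ hz => mem_piFinset_of_dotProduct_self hz

theorem dotProduct_self_eq_card {z : Fin 4 → ℤ} (hz : ∀ i, z i = -1 ∨ z i = 0 ∨ z i = 1) :
    z ⬝ᵥ z = ({i | z i ≠ 0} : Set (Fin 4)).ncard := by
  rw [Set.ncard_eq_toFinset_card', Set.toFinset_ofPred, Finset.card_filter, dotProduct]
  push_cast
  refine Finset.sum_congr rfl fun i _ => ?_
  rcases hz i with h | h | h <;> simp [h]

theorem twentyFourCell_eq : twentyFourCell = convexHull ℝ (latticePoint '' roots) := by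
  rw [twentyFourCell]
  congr 1
  ext x
  constructor
  · rintro ⟨hx, hcard⟩
    have : ∀ i, ∃ m : ℤ, x i = m ∧ (m = -1 ∨ m = 0 ∨ m = 1) := fun i => by
      rcases hx i with h | h | h
      · exact ⟨-1, by simp [h]⟩
      · exact ⟨0, by simp [h]⟩
      · exact ⟨1, by simp [h]⟩
    choose z hxz hz using this
    refine ⟨z, ?_, ?_⟩
    · simp only [hxz, Ne, Int.cast_eq_zero] at hcard
      rw [mem_roots, dotProduct_self_eq_card hz]
      exact_mod_cast hcard
    · ext i; simp [latticePoint, hxz]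
  · rintro ⟨z, hz, rfl⟩
    have hz' : ∀ i, z i = -1 ∨ z i = 0 ∨ z i = 1 := fun i => by
      simpa using Fintype.mem_piFinset.1 (mem_piFinset_of_dotProduct_self hz) i
    refine ⟨fun i => ?_, ?_⟩
    · rcases hz' i with h | h | h <;> simp [latticePoint, h]
    · rw [mem_roots, dotProduct_self_eq_card hz'] at hz
      simp only [latticePoint, Ne, Int.cast_eq_zero]
      exact_mod_cast hz

theorem dotProduct_self_nonneg_int (z : Fin 4 → ℤ) : 0 ≤ z ⬝ᵥ z :=
  Finset.sum_nonneg fun i _ => mul_self_nonneg (z i)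

/-- The squared norm `4 - 2 * (u ⬝ᵥ v)` of `u - v` is positive. -/
theorem dotProduct_le_one {u v : Fin 4 → ℤ} (hu : u ∈ roots) (hv : v ∈ roots) (h : u ≠ v) :
    u ⬝ᵥ v ≤ 1 := by
  have h0 := dotProduct_self_nonneg_int (u - v)
  have h1 : (u - v) ⬝ᵥ (u - v) ≠ 0 := fun h1 => h (sub_eq_zero.1 (dotProduct_self_eq_zero.1 h1))
  rw [mem_roots] at hu hv
  simp only [sub_dotProduct, dotProduct_sub, hu, hv, dotProduct_comm v u] at h0 h1
  omega

theorem dotProduct_le_two_of_facet {S v : Fin 4 → ℤ} (hS : S ⬝ᵥ S = 4) (hv : v ∈ roots) :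
    S ⬝ᵥ v ≤ 2 := by
  have h0 := dotProduct_self_nonneg_int (S - v)
  have h1 : (S - v) ⬝ᵥ (S - v) ≠ 0 := fun h1 => by
    rw [sub_eq_zero.1 (dotProduct_self_eq_zero.1 h1), mem_roots.1 hv] at hS
    norm_num at hS
  rw [mem_roots] at hv
  simp only [sub_dotProduct, dotProduct_sub, hS, hv, dotProduct_comm v S] at h0 h1
  omega

/-- A linear functional with integral coefficients that is at most `M` on the vertices of the
24-cell determines a face of the 24-cell. -/
theorem isExposed_twentyFourCell {S : Fin 4 → ℤ} {M : ℤ} (h : ∀ z ∈ roots, S ⬝ᵥ z ≤ M) :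
    IsExposed ℝ twentyFourCell (convexHull ℝ (latticePoint '' {z ∈ roots | S ⬝ᵥ z = M})) := by
  have h1 := isExposed_convexHull_max (s := latticePoint '' roots)
    (l := innerSL ℝ (latticePoint S)) (M := M) (by
      rintro _ ⟨z, hz, rfl⟩
      rw [innerSL_apply_apply, inner_latticePoint]
      exact_mod_cast h z hz)
  rw [twentyFourCell_eq]
  convert h1 using 2
  ext x
  constructor
  · rintro ⟨z, ⟨hz, hzM⟩, rfl⟩
    exact ⟨⟨z, hz, rfl⟩, by rw [innerSL_apply_apply, inner_latticePoint, hzM]⟩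
  · rintro ⟨⟨z, hz, rfl⟩, hzM⟩
    rw [innerSL_apply_apply, inner_latticePoint] at hzM
    exact ⟨z, ⟨hz, by exact_mod_cast hzM⟩, rfl⟩

theorem vertices_twentyFourCell : vertices twentyFourCell = latticePoint '' roots := by
  refine Set.Subset.antisymm ?_ ?_
  · rw [twentyFourCell_eq]; exact vertices_convexHull_subset _
  · rintro _ ⟨z, hz, rfl⟩
    have h := isExposed_twentyFourCell (S := z) (M := 2) fun w hw => by
      by_cases hzw : z = w
      · subst hzw; exact (mem_roots.1 hz).le
      · linarith [dotProduct_le_one hz hw hzw]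
    have h1 : {w ∈ roots | z ⬝ᵥ w = 2} = {z} := by
      ext w
      refine ⟨fun hw => ?_, fun hw => ?_⟩
      · by_contra hne
        have h2 := dotProduct_le_one hz hw.1 (Ne.symm hne)
        rw [hw.2] at h2
        norm_num at h2
      · obtain rfl : w = z := hw
        exact ⟨hz, hz⟩
    rwa [h1, Set.image_singleton, convexHull_singleton] at h

theorem vertices_inter_face {S : Fin 4 → ℤ} {M : ℤ} (h : ∀ z ∈ roots, S ⬝ᵥ z ≤ M) :
    vertices twentyFourCell ∩ convexHull ℝ (latticePoint '' {z ∈ roots | S ⬝ᵥ z = M}) =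
      latticePoint '' {z ∈ roots | S ⬝ᵥ z = M} := by
  refine Set.Subset.antisymm ?_ ?_
  · rintro v ⟨hv, hvF⟩
    refine vertices_convexHull_subset _ ?_
    exact IsExposed.mono hv (isExposed_twentyFourCell h).subset (Set.singleton_subset_iff.2 hvF)
  · rintro v hv
    refine ⟨?_, subset_convexHull ℝ _ hv⟩
    rw [vertices_twentyFourCell]
    exact Set.image_mono (Set.sep_subset _ _) hv

theorem isPolytope_twentyFourCell : IsPolytope twentyFourCell := by
  refine ⟨⟨_, finite_roots.image _, twentyFourCell_eq⟩, ?_⟩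
  rw [twentyFourCell_eq, affineSpan_convexHull]
  set A := affineSpan ℝ (latticePoint '' roots) with hA
  have hmem : ∀ z ∈ roots, latticePoint z ∈ A := fun z hz =>
    subset_affineSpan ℝ _ (Set.mem_image_of_mem _ hz)
  have hdir : ∀ u ∈ roots, ∀ v ∈ roots, latticePoint (u - v) ∈ A.direction :=
    fun u hu v hv => by
      rw [latticePoint_sub]
      exact AffineSubspace.vsub_mem_direction (hmem u hu) (hmem v hv)
  have hsingle : ∀ i : Fin 4, EuclideanSpace.single i (1 : ℝ) ∈ A.direction := fun i => by
    -- Twice each basis vector is a difference of two roots, so the direction is the whole space.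
    obtain ⟨u, hu, v, hv, huv⟩ : ∃ u : Fin 4 → ℤ, u ⬝ᵥ u = 2 ∧ ∃ v : Fin 4 → ℤ, v ⬝ᵥ v = 2 ∧
        u - v = Pi.single i 2 := by
      revert i
      refine Fin.forall_fin_succ.2 ⟨⟨![1, 1, 0, 0], by decide, ![-1, 1, 0, 0], by decide,
        by decide⟩, fun i => ⟨Pi.single 0 1 + Pi.single i.succ 1, ?_,
        Pi.single 0 1 - Pi.single i.succ 1, ?_, ?_⟩⟩ <;> revert i <;> decide
    have h1 := A.direction.smul_mem (1 / 2 : ℝ) (hdir u hu v hv)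
    convert h1 using 1
    rw [huv]
    ext j
    by_cases hij : j = i
    · subst hij; simp [latticePoint]
    · simp [latticePoint, hij]
  have htop : A.direction = ⊤ := by
    rw [eq_top_iff, ← (EuclideanSpace.basisFun (Fin 4) ℝ).toBasis.span_eq, Submodule.span_le]
    rintro _ ⟨i, rfl⟩
    simpa using hsingle i
  exact (AffineSubspace.direction_eq_top_iff_of_nonempty
    ⟨_, hmem ![1, 1, 0, 0] (by decide : (_ ⬝ᵥ _ : ℤ) = 2)⟩).1 htop

/-! ### Realizations of the 24-cell -/

/-- The point of tangency, lifted, is orthogonal to the lifts of both ends. Hence their Gram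
determinant vanishes, and positivity of its two coefficients makes the product negative. -/
theorem lorentz_of_isTangentToUnitSphere {n : ℕ} {u v : E n} (hu : 1 < ‖u‖) (hv : 1 < ‖v‖)
    (h : IsTangentToUnitSphere (segment ℝ u v)) :
    lorentz n (u, 1) (v, 1) = -(√(‖u‖ ^ 2 - 1) * √(‖v‖ ^ 2 - 1)) := by
  obtain ⟨x, ⟨a, b, ha, hb, hab, rfl⟩, -, hx⟩ := h
  have h1 := hx u (left_mem_segment ℝ u v)
  have h2 := hx v (right_mem_segment ℝ u v)
  simp only [inner_add_left, inner_smul_left, real_inner_self_eq_norm_sq, real_inner_comm u v,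
    RCLike.conj_to_real] at h1 h2
  have hu2 : 0 < ‖u‖ ^ 2 - 1 := by nlinarith
  have hv2 : 0 < ‖v‖ ^ 2 - 1 := by nlinarith
  have huv : lorentz n (u, 1) (v, 1) = ⟪u, v⟫ - 1 := by simp [lorentz_apply]
  rw [huv, ← Real.sqrt_mul hu2.le]
  set p := ‖u‖ ^ 2 - 1 with hp
  set q := ‖v‖ ^ 2 - 1 with hq
  set r := ⟪u, v⟫ - 1 with hr
  have e1 : a * p + b * r = 0 := by
    have : a * p + b * r = a * ‖u‖ ^ 2 + b * ⟪u, v⟫ - (a + b) := by rw [hp, hr]; ring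
    rw [this, hab]; linarith [real_inner_comm u v]
  have e2 : a * r + b * q = 0 := by
    have : a * r + b * q = a * ⟪u, v⟫ + b * ‖v‖ ^ 2 - (a + b) := by rw [hq, hr]; ring
    rw [this, hab]; linarith [real_inner_comm u v]
  have ha' : 0 < a := by
    refine ha.lt_of_ne fun h => ?_
    subst h
    obtain rfl : b = 1 := by linarith
    linarith
  have hb' : 0 < b := by
    refine hb.lt_of_ne fun h => ?_
    subst h
    obtain rfl : a = 1 := by linarith
    linarith
  have hr0 : r < 0 := by
    by_contra! h
    have := mul_pos ha' hu2
    have := mul_nonneg hb'.le h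
    linarith
  have hsq : p * q = (-r) ^ 2 := by
    have : a * b * (p * q - (-r) ^ 2) = 0 := by
      linear_combination (b * q) * e1 - b * r * e2
    have := (mul_eq_zero.1 this).resolve_left (mul_pos ha' hb').ne'
    linarith
  rw [hsq, Real.sqrt_sq (by linarith), neg_neg]

/-- The lift of a point outside the unit sphere to a unit vector of the Lorentz space. -/
def unitLift {n : ℕ} (v : E n) : E n × ℝ := (√(‖v‖ ^ 2 - 1))⁻¹ • (v, 1)

/-- The lattice isomorphism carries edges and octahedra of the 24-cell to faces of `Q`: tangency
then gives the products `-1`, and the supporting hyperplanes of the facets give the functionals `ℓ`.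
-/
theorem IsEdgeScribedRealization.exists_configuration {Q : Set (E 4)}
    (h : IsEdgeScribedRealization twentyFourCell Q) :
    ∃ y : (Fin 4 → ℤ) → E 4, y '' roots = vertices Q ∧ (∀ v ∈ vertices Q, 1 < ‖v‖) ∧
      IsConfiguration fun z => unitLift (y z) := by
  obtain ⟨⟨hQ, hout, hedge⟩, hcomb⟩ := h
  obtain ⟨ψ, hψ, hface⟩ := hcomb.exists_bijOn isPolytope_twentyFourCell hQ
  rw [vertices_twentyFourCell] at hψ
  have hy : ∀ z ∈ roots, ψ (latticePoint z) ∈ vertices Q := fun z hz =>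
    hψ.mapsTo (Set.mem_image_of_mem _ hz)
  have hinj : ∀ u ∈ roots, ∀ v ∈ roots, ψ (latticePoint u) = ψ (latticePoint v) → u = v :=
    fun u hu v hv huv => latticePoint_injective
      (hψ.injOn (Set.mem_image_of_mem _ hu) (Set.mem_image_of_mem _ hv) huv)
  have hpos : ∀ z ∈ roots, 0 < ‖ψ (latticePoint z)‖ ^ 2 - 1 := fun z hz => by
    have := hout _ (hy z hz)
    nlinarith
  have hface' : ∀ {S : Fin 4 → ℤ} {M : ℤ}, (∀ z ∈ roots, S ⬝ᵥ z ≤ M) →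
      IsExposed ℝ Q (convexHull ℝ ((fun z => ψ (latticePoint z)) '' {z ∈ roots | S ⬝ᵥ z = M})) ∧
      ((∃ z ∈ roots, S ⬝ᵥ z ≠ M) →
        convexHull ℝ ((fun z => ψ (latticePoint z)) '' {z ∈ roots | S ⬝ᵥ z = M}) ≠ Q) := by
    intro S M hS
    have h1 := hface _ (isExposed_twentyFourCell hS)
    rw [vertices_inter_face hS, Set.image_image] at h1
    refine ⟨h1.1, fun ⟨z, hz, hzM⟩ => h1.2 fun heq => ?_⟩
    have h2 := vertices_inter_face hS
    rw [heq] at h2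
    have h3 : latticePoint z ∈ vertices twentyFourCell ∩ twentyFourCell := by
      rw [vertices_twentyFourCell, twentyFourCell_eq]
      exact ⟨⟨z, hz, rfl⟩, subset_convexHull ℝ _ ⟨z, hz, rfl⟩⟩
    rw [h2] at h3
    obtain ⟨w, hw, hwz⟩ := h3
    rw [latticePoint_injective hwz] at hw
    exact hzM hw.2
  refine ⟨fun z => ψ (latticePoint z), ?_, hout, ?_⟩
  · rw [← hψ.image_eq, Set.image_image]
  refine ⟨fun z hz => ?_, fun z hz => ?_, fun u v hu hv huv => ?_, fun u v hu hv huv => ?_,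
    fun S hS => ?_⟩
  · have h1 := hpos z hz
    have h2 : lorentz 4 (ψ (latticePoint z), 1) (ψ (latticePoint z), 1) =
        ‖ψ (latticePoint z)‖ ^ 2 - 1 := by simp [lorentz_apply]
    simp only [unitLift, map_smul, LinearMap.smul_apply, smul_eq_mul, h2]
    nth_rewrite 3 [← Real.sq_sqrt h1.le]
    have := (Real.sqrt_pos.2 h1).ne'
    field_simp
  · simpa [unitLift] using hpos z hz
  · have hne : u ≠ v := by
      rintro rfl
      rw [huv] at hu
      norm_num at hu
    -- The functional `u + v` takes the value `2 + 1 = 3` at the two ends and at most `1 + 1` at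
    -- every other root.
    have h1 := @hface' (u + v) 3 fun z hz => by
      rw [add_dotProduct]
      by_cases hzu : u = z
      · subst hzu
        rw [hu, dotProduct_comm, huv]
        norm_num
      · have h2 := dotProduct_le_one hu hz hzu
        by_cases hzv : v = z
        · subst hzv
          rw [hv, huv]
          norm_num
        · linarith [dotProduct_le_one hv hz hzv]
    have h2 : {z ∈ roots | (u + v) ⬝ᵥ z = 3} = {u, v} := by
      ext z
      refine ⟨fun hz => ?_, fun hz => ?_⟩
      · by_contra hne
        have hz1 := dotProduct_le_one hu hz.1 fun h => hne (Or.inl h.symm)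
        have hz2 := dotProduct_le_one hv hz.1 fun h => hne (Or.inr h.symm)
        have hz3 := hz.2
        rw [add_dotProduct] at hz3
        linarith
      · rcases hz with rfl | rfl
        · exact ⟨hu, by rw [add_dotProduct, hu, dotProduct_comm, huv]; norm_num⟩
        · exact ⟨hv, by rw [add_dotProduct, hv, huv]; norm_num⟩
    rw [h2, Set.image_pair, convexHull_pair] at h1
    have h3 := lorentz_of_isTangentToUnitSphere (hout _ (hy u hu)) (hout _ (hy v hv))
      (hedge _ ⟨h1.1, _, _, fun h => hne (hinj u hu v hv h), rfl⟩)
    simp only [unitLift, map_smul, LinearMap.smul_apply, smul_eq_mul, h3]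
    have := (Real.sqrt_pos.2 (hpos u hu)).ne'
    have := (Real.sqrt_pos.2 (hpos v hv)).ne'
    field_simp
  · refine hinj u hu v hv ?_
    simp only [unitLift, Prod.smul_mk, smul_eq_mul, mul_one, Prod.mk.injEq] at huv
    rw [huv.2] at huv
    have := (Real.sqrt_pos.2 (hpos v hv)).ne'
    exact smul_right_injective _ (inv_ne_zero this) huv.1
  · obtain ⟨h1, h2⟩ := @hface' S 2 fun z hz => dotProduct_le_two_of_facet hS hz
    have h3 := h2 (by
      by_contra! hall
      have e1 := hall ![1, 1, 0, 0] (by decide : (_ ⬝ᵥ _ : ℤ) = 2)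
      have e2 := hall (-![1, 1, 0, 0]) (by decide : (_ ⬝ᵥ _ : ℤ) = 2)
      rw [dotProduct_neg, e1] at e2
      norm_num at e2)
    rcases Set.eq_empty_or_nonempty
      (convexHull ℝ ((fun z => ψ (latticePoint z)) '' {z ∈ roots | S ⬝ᵥ z = 2})) with h4 | h4
    · refine ⟨LinearMap.snd ℝ _ _, fun h => ?_, fun z hz hzS => ?_⟩
      · have := LinearMap.congr_fun h (0, 1)
        simp at this
      · rw [convexHull_eq_empty, Set.image_eq_empty] at h4
        exact absurd ⟨hz, hzS⟩ (Set.eq_empty_iff_forall_notMem.1 h4 z)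
    · obtain ⟨l, hl⟩ := h1 h4
      obtain ⟨x₀, hx₀⟩ := h4
      rw [hl] at hx₀
      -- Homogenizing the equation `l = l x₀` gives a linear functional vanishing on the lifts. It
      -- is nonzero, since `l = 0` would expose all of `Q`.
      refine ⟨l.toLinearMap.comp (LinearMap.fst ℝ _ _) - l x₀ • LinearMap.snd ℝ _ _, fun h => ?_,
        fun z hz hzS => ?_⟩
      · refine h3 (hl.trans (Set.sep_eq_self_iff_mem_true.2 fun x _ y _ => ?_))
        have hzero : ∀ w, l w = 0 := fun w => by simpa using LinearMap.congr_fun h (w, 0)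
        rw [hzero, hzero]
      · have h5 : ψ (latticePoint z) ∈
            convexHull ℝ ((fun z => ψ (latticePoint z)) '' {z ∈ roots | S ⬝ᵥ z = 2}) :=
          subset_convexHull ℝ _ ⟨z, ⟨hz, hzS⟩, rfl⟩
        rw [hl] at h5
        have h6 : l (ψ (latticePoint z)) = l x₀ :=
          le_antisymm (hx₀.2 _ h5.1) (h5.2 _ hx₀.1)
        simp [unitLift, h6, mul_comm]

theorem ballArrangement_eq {d : ℕ} {P : Set (E (d + 1))} (h : ∀ v ∈ vertices P, 1 < ‖v‖) :
    ballArrangement P = (fun v => region (unitLift v)) '' vertices P := by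
  refine Set.image_congr fun v hv => ?_
  have h1 := h v hv
  have h2 : 0 < ‖v‖ ^ 2 - 1 := by nlinarith
  rw [stereo_image_illuminated, unitLift, region_smul (inv_pos.2 (Real.sqrt_pos.2 h2))]

theorem mobiusEquivalent_of_realizations {Q Q' : Set (E (3 + 1))}
    (h : IsEdgeScribedRealization twentyFourCell Q)
    (h' : IsEdgeScribedRealization twentyFourCell Q') :
    MobiusEquivalent (ballArrangement Q) (ballArrangement Q') := by
  obtain ⟨y, hy, hout, hconf⟩ := h.exists_configuration
  obtain ⟨y', hy', hout', hconf'⟩ := h'.exists_configuration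
  obtain ⟨f, hf, hfy⟩ := hconf.exists_inducesMobius hconf'
  obtain ⟨μ, hμ, hreg⟩ := hf.exists_image_region
  refine ⟨μ, hμ, ?_⟩
  rw [ballArrangement_eq hout, ballArrangement_eq hout', ← hy, ← hy', Set.image_image,
    Set.image_image, Set.image_image]
  exact Set.image_congr fun z hz => by rw [hreg, hfy z hz]

/-! ### The edge-scribed 24-cell -/

/-- The sum of two vertices of the 24-cell that are not adjacent is the sum of two other
vertices. -/
theorem exists_add_eq_add {u v : Fin 4 → ℤ} (hu : u ∈ roots) (hv : v ∈ roots) (huv : u ≠ v)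
    (h : u ⬝ᵥ v ≠ 1) : ∃ w ∈ roots, u + v - w ∈ roots ∧ w ≠ u ∧ w ≠ v := by
  have key : ∀ u ∈ Fintype.piFinset (fun _ : Fin 4 => ({-1, 0, 1} : Finset ℤ)), u ⬝ᵥ u = 2 →
      ∀ v ∈ Fintype.piFinset (fun _ : Fin 4 => ({-1, 0, 1} : Finset ℤ)), v ⬝ᵥ v = 2 → u ≠ v →
      u ⬝ᵥ v ≠ 1 → ∃ w ∈ Fintype.piFinset (fun _ : Fin 4 => ({-1, 0, 1} : Finset ℤ)),
      w ⬝ᵥ w = 2 ∧ (u + v - w) ⬝ᵥ (u + v - w) = 2 ∧ w ≠ u ∧ w ≠ v := by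
    decide +kernel
  obtain ⟨w, -, hw⟩ := key u (mem_piFinset_of_dotProduct_self hu) hu v
    (mem_piFinset_of_dotProduct_self hv) hv huv h
  exact ⟨w, hw⟩

/-- For nonadjacent `u` and `v`, another pair of roots has the same sum; a functional maximal at `u`
and `v` is then maximal at that pair, putting a third vertex on the segment. -/
theorem dotProduct_eq_one_of_edge {u v : Fin 4 → ℤ} (hu : u ∈ roots) (hv : v ∈ roots)
    (huv : u ≠ v)
    (h : IsExposed ℝ twentyFourCell (segment ℝ (latticePoint u) (latticePoint v))) :
    u ⬝ᵥ v = 1 := by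
  by_contra hne
  obtain ⟨w, hw, hw', hwu, hwv⟩ := exists_add_eq_add hu hv huv hne
  have hmem : ∀ z ∈ roots, latticePoint z ∈ twentyFourCell := fun z hz => by
    rw [twentyFourCell_eq]; exact subset_convexHull ℝ _ ⟨z, hz, rfl⟩
  obtain ⟨l, hl⟩ := h ⟨_, left_mem_segment ℝ _ _⟩
  have hu' := left_mem_segment ℝ (latticePoint u) (latticePoint v)
  have hv' := right_mem_segment ℝ (latticePoint u) (latticePoint v)
  rw [hl] at hu' hv'
  have hsum : l (latticePoint u) + l (latticePoint v) =
      l (latticePoint w) + l (latticePoint (u + v - w)) := by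
    rw [← map_add, ← map_add, ← latticePoint_add, ← latticePoint_add, add_sub_cancel]
  have h1 := hu'.2 _ (hmem w hw)
  have h2 := hv'.2 _ (hmem _ hw')
  have h3 : latticePoint w ∈ segment ℝ (latticePoint u) (latticePoint v) := by
    rw [hl]
    exact ⟨hmem w hw, fun y hy => (hu'.2 y hy).trans (by linarith)⟩
  have hwvert : latticePoint w ∈ vertices twentyFourCell := by
    rw [vertices_twentyFourCell]; exact ⟨w, hw, rfl⟩
  rcases vertex_mem_of_mem_segment hwvert (hmem u hu) (hmem v hv) h3 with h4 | h4
  · exact hwu (latticePoint_injective h4)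
  · exact hwv (latticePoint_injective h4)

theorem exists_edgeScribedRealization :
    ∃ Q : Set (E 4), IsEdgeScribedRealization twentyFourCell Q := by
  -- An edge midpoint of the unscaled cell has squared norm `(2 + 2 + 2 * 1) / 4 = 3 / 2`.
  have hc : (√(2 / 3) : ℝ) ≠ 0 := by positivity
  have hc2 : √(2 / 3 : ℝ) ^ 2 = 2 / 3 := Real.sq_sqrt (by norm_num)
  set e : E 4 ≃L[ℝ] E 4 := ContinuousLinearEquiv.smulLeft (Units.mk0 (√(2 / 3) : ℝ) hc) with he
  have heq : ∀ x, e x = √(2 / 3 : ℝ) • x := fun x => rfl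
  have hback : ∀ F : Set (E 4), IsExposed ℝ (e '' twentyFourCell) F →
      IsExposed ℝ twentyFourCell (e.symm '' F) := fun F hF => by
    simpa [Set.image_image] using isExposed_image e.symm hF
  have hvert : ∀ v ∈ vertices (e '' twentyFourCell), ∃ z ∈ roots, v = e (latticePoint z) :=
    fun v hv => by
      have h1 := hback _ hv
      rw [Set.image_singleton] at h1
      have h2 : e.symm v ∈ vertices twentyFourCell := h1
      rw [vertices_twentyFourCell] at h2
      obtain ⟨z, hz, hzv⟩ := h2
      exact ⟨z, hz, by rw [hzv, e.apply_symm_apply]⟩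
  have hpoly : IsPolytope (e '' twentyFourCell) := by
    refine ⟨⟨e '' (latticePoint '' roots), (finite_roots.image _).image _, ?_⟩, ?_⟩
    · rw [twentyFourCell_eq]
      exact (e : E 4 →ₗ[ℝ] E 4).image_convexHull _
    · exact AffineMap.span_eq_top_of_surjective (e.toLinearEquiv.toAffineEquiv : E 4 →ᵃ[ℝ] E 4)
        e.surjective isPolytope_twentyFourCell.2
  refine ⟨e '' twentyFourCell, ⟨hpoly, ?_, ?_⟩, combEquiv_image e _⟩
  · intro v hv
    obtain ⟨z, hz, rfl⟩ := hvert v hv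
    have h1 : ‖e (latticePoint z)‖ ^ 2 = 4 / 3 := by
      rw [heq, norm_smul, mul_pow, Real.norm_eq_abs, sq_abs, hc2, ← real_inner_self_eq_norm_sq,
        inner_latticePoint, mem_roots.1 hz]
      norm_num
    have := norm_nonneg (e (latticePoint z))
    nlinarith
  · rintro _ ⟨hF, a, b, hab, rfl⟩
    obtain ⟨u, hu, rfl⟩ := hvert a (hpoly.left_mem_vertices hF hab)
    obtain ⟨v, hv, rfl⟩ := hvert b (hpoly.left_mem_vertices (segment_symm ℝ _ b ▸ hF) hab.symm)
    have hF' := hback _ hF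
    have himg : e.symm '' segment ℝ (e (latticePoint u)) (e (latticePoint v)) =
        segment ℝ (latticePoint u) (latticePoint v) := by
      have := image_segment ℝ (e.symm : E 4 →ₗ[ℝ] E 4).toAffineMap (e (latticePoint u))
        (e (latticePoint v))
      simpa using this
    rw [himg] at hF'
    have huv := dotProduct_eq_one_of_edge hu hv (fun h => hab (by rw [h])) hF'
    have hvu : v ⬝ᵥ u = 1 := by rw [dotProduct_comm, huv]
    have hi : ∀ u v : Fin 4 → ℤ, ⟪e (latticePoint u), e (latticePoint v)⟫ =
        2 / 3 * ((u ⬝ᵥ v : ℤ) : ℝ) := fun u v => by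
      rw [heq, heq, real_inner_smul_left, real_inner_smul_right, inner_latticePoint, ← mul_assoc,
        ← sq, hc2]
    refine ⟨(1 / 2 : ℝ) • e (latticePoint u) + (1 / 2 : ℝ) • e (latticePoint v),
      ⟨1 / 2, 1 / 2, by norm_num, by norm_num, by norm_num, rfl⟩, ?_, ?_⟩
    · rw [← sq_eq_sq₀ (norm_nonneg _) zero_le_one, ← real_inner_self_eq_norm_sq]
      simp only [inner_add_left, inner_add_right, real_inner_smul_left, real_inner_smul_right, hi,
        huv, hvu, mem_roots.1 hu, mem_roots.1 hv]
      norm_num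
    · rintro _ ⟨s, t, hs, ht, hst, rfl⟩
      simp only [inner_add_left, inner_add_right, real_inner_smul_left, real_inner_smul_right, hi,
        huv, hvu, mem_roots.1 hu, mem_roots.1 hv]
      push_cast
      linarith

end MobiusPolytope

end

theorem mainTheorem4 : MobiusPolytope.IsMobiusUnique MobiusPolytope.twentyFourCell :=
  ⟨MobiusPolytope.exists_edgeScribedRealization,
    fun _ _ h h' => MobiusPolytope.mobiusEquivalent_of_realizations h h'⟩
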